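/- Let $P_\nu^\mu$ ($\nu,\mu\in\mathbb{C}$) be Hobson's associated Legendre function of the first kind on $\mathbb{C}\setminus(-\infty,1]$, $$P_\nu^\mu(z)=\frac{1}{\Gamma(1-\mu)}\left(\frac{z+1}{z-1}\right)^{\mu/2}{}_2F_1\left(-\nu,\nu+1;1-\mu;\frac{1-z}{2}\right),$$ where $\frac{1}{\Gamma(c)}\,{}_2F_1(a,b;c;w)$ denotes the analytic continuation to $w\in\mathbb{C}\setminus[1,\infty)$ of the series $\sum_{k\ge0}\frac{(a)_k(b)_k}{\Gamma(c+k)\,k!}w^k$. All powers of $z\pm1$ are taken with $-\pi<\arg(z\pm1)<\pi$; thus $\left(\frac{z+1}{z-1}\right)^{\alpha}=\frac{(z+1)^{\alpha}}{(z-1)^{\alpha}}$ and $\left(\frac{z^2-1}{4}\right)^{\alpha}=\frac{(z-1)^{\alpha}(z+1)^{\alpha}}{4^{\alpha}}$. Let $\psi=\Gamma'/\Gamma$. For integers $0\le m\le n$, the associated Legendre function of the second kind is defined for $\operatorname{Im} z\gtrless0$ by $$Q_n^m(z)=\lim_{\nu\to n}\frac{\pi}{2}\,\mathrm{e}^{\mathrm{i}\pi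 m}\,\frac{\mathrm{e}^{\mp\mathrm{i}\pi\nu}P_\nu^m(z)-P_\nu^m(-z)}{\sin[\pi(\nu+m)]},$$ and for real $z>1$ as the limit of $Q_n^m(w)$ as $w\to z$ through non-real $w$. Let $0\le m\le n$ be integers. Then these limits exist, and for every $z\in\mathbb{C}\setminus(-\infty,1]$ the following formula holds, both with all upper signs and with all lower signs (the two choices of sign are independent of the sign of $\operatorname{Im} z$; empty sums are zero): $$\begin{aligned} Q_n^m(z)={}&\frac12P_n^m(z)\ln\frac{z+1}{z-1}\mp\psi(n+m+1)P_n^m(z)\\ &\pm\frac{(\pm1)^n(\mp1)^m}{2}\frac{(n+m)!}{(n-m)!}\left(\frac{z^2-1}{4}\right)^{-m/2}\sum_{k=0}^{m-1}(\mp1)^k\frac{(k+n-m)!\,(m-k-1)!}{k!\,(n+m-k)!}\left(\frac{z\mp1}{2}\right)^k\\ &\pm\frac{(\pm1)^{n+m}}{2}\left(\frac{z^2-1}{4}\right)^{m/2}\sum_{k=0}^{n-m}(\pm1)^k\frac{(k+n+m)!}{k!\,(k+m)!\,(n-m-k)!}\,[2\psi(k+n+m+1)-\psi(k+m+1)]\left(\frac{z\mp1}{2}\right)^k\\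 &\mp\frac{(\pm1)^n}{2}\frac{(n+m)!}{(n-m)!}\left(\frac{z\mp1}{z\pm1}\right)^{m/2}\sum_{k=0}^{n}(\pm1)^k\frac{(k+n)!}{k!\,(k+m)!\,(n-k)!}\,[2\psi(k+n+1)-2\psi(k+m+1)-\psi(k+1)]\left(\frac{z\mp1}{2}\right)^k. \end{aligned}$$ -/

import Mathlib

open Filter Topology

noncomputable section

/-- The plane cut along the real half-line `[1, ∞)`. -/
def hypDomain : Set ℂ := {w | 1 - w ∈ Complex.slitPlane}

/-- The regularized Gauss series `∑ (a)_k (b)_k / (Γ(c + k) k!) w ^ k`. It converges for `‖w‖ < 1`.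
Since `Complex.Gamma` has value `0` at its poles, `(Γ(c + k))⁻¹` is the entire function `1 / Γ`. -/
def regHypSeries (a b c w : ℂ) : ℂ :=
  ∑' k : ℕ, (ascPochhammer ℂ k).eval a * (ascPochhammer ℂ k).eval b *
    (Complex.Gamma (c + k))⁻¹ / (k.factorial : ℂ) * w ^ k

/-- `f` is an analytic continuation of the regularized Gauss series to `ℂ \ [1, ∞)`. -/
def IsRegHyp (a b c : ℂ) (f : ℂ → ℂ) : Prop :=
  DifferentiableOn ℂ f hypDomain ∧ ∀ w ∈ Metric.ball (0 : ℂ) 1, f w = regHypSeries a b c w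

/-- The analytic continuation is unique on the cut plane. -/
theorem IsRegHyp.eqOn {a b c : ℂ} {f g : ℂ → ℂ} (hf : IsRegHyp a b c f) (hg : IsRegHyp a b c g) :
    Set.EqOn f g hypDomain := by
  have hopen : IsOpen hypDomain :=
    Complex.isOpen_slitPlane.preimage (by fun_prop : Continuous fun w : ℂ => 1 - w)
  have hstar : StarConvex ℝ (0 : ℂ) hypDomain := by
    intro w hw s t hs ht hst
    have h := Complex.starConvex_one_slitPlane hw hs ht hst
    have e : (1 : ℂ) - (s • (0 : ℂ) + t • w) = s • (1 : ℂ) + t • (1 - w) := by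
      have : (s : ℂ) + t = 1 := by exact_mod_cast hst
      simp only [Complex.real_smul]
      linear_combination -this
    change 1 - (s • (0 : ℂ) + t • w) ∈ Complex.slitPlane
    rw [e]
    exact h
  have h0 : (0 : ℂ) ∈ hypDomain := by simp [hypDomain]
  refine (hf.1.analyticOnNhd hopen).eqOn_of_preconnected_of_eventuallyEq
    (hg.1.analyticOnNhd hopen) (hstar.isPathConnected h0).isConnected.isPreconnected h0 ?_
  filter_upwards [Metric.ball_mem_nhds (0 : ℂ) one_pos] with w hw
  rw [hf.2 w hw, hg.2 w hw]

open Classical in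
/-- The regularized hypergeometric function `₂F₁(a, b; c; w) / Γ(c)`: the principal branch, i.e. the
analytic continuation of the Gauss series to `ℂ \ [1, ∞)`. -/
def regHyp (a b c : ℂ) : ℂ → ℂ :=
  if h : ∃ f, IsRegHyp a b c f then h.choose else regHypSeries a b c

/-- The domain of the Legendre functions: the plane cut along the real half-line `(-∞, 1]`. -/
def legendreDomain : Set ℂ := {z | z - 1 ∈ Complex.slitPlane}

/-- The associated Legendre function of the first kind (Hobson)
`P_ν^μ(z) = ((z + 1) / (z - 1)) ^ (μ / 2) ₂F₁(-ν, ν + 1; 1 - μ; (1 - z) / 2) / Γ(1 - μ)`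
with `-π < arg (z ± 1) < π`. -/
def legendreP (ν μ z : ℂ) : ℂ :=
  (z + 1) ^ (μ / 2) / (z - 1) ^ (μ / 2) * regHyp (-ν) (ν + 1) (1 - μ) ((1 - z) / 2)

/-- The combination of `P_ν^μ(z)` and `P_ν^μ(-z)` that defines `Q_ν^μ(z)` off the real axis when
`ν + μ` is not an integer; the sign in `e ^ (∓ i π ν)` is that of `∓ Im z`. -/
def legendreQuot (ν μ z : ℂ) : ℂ :=
  (Real.pi / 2 : ℂ) * Complex.exp (Complex.I * Real.pi * μ) *
    ((if 0 < z.im then Complex.exp (-(Complex.I * Real.pi * ν))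
        else Complex.exp (Complex.I * Real.pi * ν)) * legendreP ν μ z - legendreP ν μ (-z)) /
    Complex.sin (Real.pi * (ν + μ))

/-- The associated Legendre function of the second kind at non-real `z`, as the limit in the degree
of the defining quotient; this fills in the removable singularities at integer `ν + μ`
(for negative integer `ν + μ` there may be a pole, where `Q_ν^μ` is undefined). -/
def legendreQNonreal (ν μ z : ℂ) : ℂ :=
  limUnder (𝓝[≠] ν) fun ν' => legendreQuot ν' μ z

open Classical in
/-- The associated Legendre function of the second kind (Hobson) on the plane cut along `(-∞, 1]`:
at real `z > 1` it is defined by continuity. -/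
def legendreQ (ν μ z : ℂ) : ℂ :=
  if z.im ≠ 0 then legendreQNonreal ν μ z
  else limUnder (𝓝[{w : ℂ | w.im ≠ 0}] z) fun w => legendreQNonreal ν μ w

end

/-! Put w = (1 - z)/2. Up to an algebraic prefactor, P_ν^m is the regularized Gauss function F(ν, w)
with parameters -ν, ν + 1, 1 - m. The parity of its polynomial factor `legF` under w ↦ 1 - w makes
the numerator defining Q_n^m vanish at ν = n, so by l'Hôpital everything reduces to ∂F/∂ν at ν = n.

Existence of this derivative on the whole cut plane: by the reflection formula the coefficients with
k > n carry the factor sin(πν)/π. The rest of the tail is rewritten with Γ(k - ν) Γ(k + ν + 1) =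
(2k)! B(k - ν, k + ν + 1) as a beta-weighted integral of an elementary kernel, holomorphic in w and
continuous in ν at n. The sine vanishes at n, so continuity is enough (`hasDerivAt_regHyp`).

Its value: differentiating the coefficient recursion in ν shows that ∂F/∂ν, stripped of w^m, solves
a hypergeometric equation with right-hand side -(2n + 1) `legF`. After Euler's transformation its
power series solutions are r log(1 - w) + s, where r = (1 - w)^m `legF` is `legR` and s is a
polynomial of degree at most n that stays implicit (`exists_eq_log_add`, `exists_legHypDeriv_eq`).
L'Hôpital then gives `legQClosed`: half of P_n^m times the logarithm, plus a multiple of w^m s(w) -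
(-1)^(n+m) (1 - w)^m s(1 - w). This combination is unchanged when a multiple of r is added to s.

The finite sums: by `legF_combination` the combination is the polynomial assembled from the three
sums. Both sides satisfy the same inhomogeneous equation, have degree at most n + m and no term of
degree n + m, and the operator is injective below that degree. The weights enter only through their
differences in k and one boundary relation, both supplied by the recurrence of ψ. Evaluation at w
gives the upper signs, evaluation at 1 - w the lower ones, since the combination only changes by a
sign under the exchange. Real z > 1 follows by continuity of the closed form. -/

noncomputable section

/-- The Gauss hypergeometric differential operator with parameters `a`, `b`, `c` in a commutative
`ℂ`-algebra with derivation `δ` and variable `x`. -/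
def hypOp {R : Type*} [CommRing R] [Algebra ℂ R] (δ : Derivation ℂ R R) (x : R) (a b c : ℂ)
    (y : R) : R :=
  x * (1 - x) * δ (δ y) + (algebraMap ℂ R c - algebraMap ℂ R (a + b + 1) * x) * δ y
    - algebraMap ℂ R (a * b) * y

/-! ### Gauge transformations of the hypergeometric operator. -/

section HypOp

variable {R : Type*} [CommRing R] [Algebra ℂ R] (δ : Derivation ℂ R R) {x : R}

theorem hypOp_add (a b c : ℂ) (y z : R) :
    hypOp δ x a b c (y + z) = hypOp δ x a b c y + hypOp δ x a b c z := by
  simp only [hypOp, map_add]; ring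

theorem hypOp_sub (a b c : ℂ) (y z : R) :
    hypOp δ x a b c (y - z) = hypOp δ x a b c y - hypOp δ x a b c z := by
  simp only [hypOp, map_sub]; ring

theorem hypOp_const_mul (a b c t : ℂ) (y : R) :
    hypOp δ x a b c (algebraMap ℂ R t * y) = algebraMap ℂ R t * hypOp δ x a b c y := by
  simp only [hypOp, Derivation.leibniz, smul_eq_mul, Derivation.map_algebraMap, mul_zero, add_zero]
  ring

theorem hypOp_swap (a b c : ℂ) (y : R) : hypOp δ x a b c y = hypOp δ x b a c y := by
  simp only [hypOp, add_comm a b, mul_comm a b]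

/-- The extra factor x avoids the truncated exponent m - 1, so m = 0 needs no separate treatment
later. The next three lemmas have the same form for the same reason. -/
theorem mul_derivation_pow (hx : δ x = 1) (m : ℕ) : x * δ (x ^ m) = m * x ^ m := by
  cases m with
  | zero => simp
  | succ m => rw [Derivation.leibniz_pow, hx]; simp; ring

theorem mul_derivation_derivation_pow (hx : δ x = 1) (m : ℕ) :
    x * δ (δ (x ^ m)) = (m - 1) * δ (x ^ m) := by
  have h := congrArg δ (mul_derivation_pow δ hx m)
  simp only [Derivation.leibniz, hx, smul_eq_mul, Derivation.map_natCast] at h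
  linear_combination h

theorem one_sub_mul_derivation_pow (hx : δ x = 1) (m : ℕ) :
    (1 - x) * δ ((1 - x) ^ m) = -m * (1 - x) ^ m := by
  cases m with
  | zero => simp
  | succ m => rw [Derivation.leibniz_pow, map_sub, hx]; simp; ring

theorem one_sub_mul_derivation_derivation_pow (hx : δ x = 1) (m : ℕ) :
    (1 - x) * δ (δ ((1 - x) ^ m)) = (1 - m) * δ ((1 - x) ^ m) := by
  have h := congrArg δ (one_sub_mul_derivation_pow δ hx m)
  simp only [Derivation.leibniz, map_sub, hx, smul_eq_mul, Derivation.map_natCast, map_neg,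
    Derivation.map_one_eq_zero] at h
  linear_combination h

/-- Euler's transformation. -/
theorem hypOp_one_sub_pow_mul (hx : δ x = 1) {a b c : ℂ} (m : ℕ) (h : a + b - c = m) (y : R) :
    hypOp δ x (c - a) (c - b) c ((1 - x) ^ m * y) = (1 - x) ^ m * hypOp δ x a b c y := by
  obtain rfl : c = a + b - m := by linear_combination -h
  have h1 := one_sub_mul_derivation_pow δ hx m
  have h2 := one_sub_mul_derivation_derivation_pow δ hx m
  simp only [hypOp, Derivation.leibniz, map_add, map_sub, map_mul, smul_eq_mul, map_one,
    map_natCast]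
  linear_combination (x * y) * h2 +
    (2 * x * δ y + y * (algebraMap ℂ R a + algebraMap ℂ R b - m)) * h1

/-- For c = 1 - m the exponents at 0 are 0 and m; the second one is split off here. -/
theorem hypOp_pow_mul (hx : δ x = 1) (a b : ℂ) (m : ℕ) (y : R) :
    hypOp δ x a b (1 - m) (x ^ m * y) = x ^ m * hypOp δ x (a + m) (b + m) (1 + m) y := by
  have h1 := mul_derivation_pow δ hx m
  have h2 := mul_derivation_derivation_pow δ hx m
  simp only [hypOp, Derivation.leibniz, map_add, map_sub, map_mul, smul_eq_mul, map_one,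
    map_natCast]
  linear_combination ((1 - x) * y) * h2 +
    (2 * (1 - x) * δ y - y * (algebraMap ℂ R a + algebraMap ℂ R b + m)) * h1

end HypOp

/-! ### The operator on coefficients of polynomials and power series. -/

open Polynomial in
/-- The hypergeometric operator on polynomials. -/
abbrev polyHyp (a b c : ℂ) (y : ℂ[X]) : ℂ[X] := hypOp derivative' X a b c y

open PowerSeries in
/-- The hypergeometric operator on formal power series. -/
abbrev seriesHyp (a b c : ℂ) (y : ℂ⟦X⟧) : ℂ⟦X⟧ := hypOp (d⁄dX ℂ) X a b c y

-- The operator is a two-term recursion. Nonvanishing of k + c lets one solve upwards from the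
-- constant coefficient; nonvanishing of (k + a)(k + b) lets one solve downwards from the degree.
-- Both uniqueness statements and the solver below rest on this.
open PowerSeries in
theorem coeff_seriesHyp (a b c : ℂ) (y : ℂ⟦X⟧) (k : ℕ) :
    coeff k (seriesHyp a b c y) =
      (k + 1) * (k + c) * coeff (k + 1) y - (k + a) * (k + b) * coeff k y := by
  have e : seriesHyp a b c y = X * (d⁄dX ℂ (d⁄dX ℂ y)) - X * (X * (d⁄dX ℂ (d⁄dX ℂ y)))
      + C c * (d⁄dX ℂ y) - C (a + b + 1) * (X * (d⁄dX ℂ y)) - C (a * b) * y := by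
    simp only [seriesHyp, hypOp, PowerSeries.algebraMap_eq]; ring
  rw [e]
  simp only [map_sub, map_add _ (_ : ℂ⟦X⟧), coeff_C_mul, coeff_derivative]
  rcases k with _ | _ | k
  · simp only [coeff_zero_X_mul]; push_cast; ring
  · simp only [coeff_succ_X_mul, coeff_zero_X_mul, coeff_derivative]; push_cast; ring
  · simp only [coeff_succ_X_mul, coeff_derivative]; push_cast; ring

open Polynomial in
theorem coe_polyHyp (a b c : ℂ) (y : ℂ[X]) :
    ((polyHyp a b c y : ℂ[X]) : PowerSeries ℂ) = seriesHyp a b c y := by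
  simp only [polyHyp, seriesHyp, hypOp, PowerSeries.algebraMap_eq, Polynomial.algebraMap_eq,
    Polynomial.coe_add, Polynomial.coe_sub, Polynomial.coe_mul, Polynomial.coe_X,
    Polynomial.coe_C, Polynomial.coe_one]
  simp [PowerSeries.derivative_coe]

open Polynomial in
theorem coeff_polyHyp (a b c : ℂ) (y : ℂ[X]) (k : ℕ) :
    (polyHyp a b c y).coeff k =
      (k + 1) * (k + c) * y.coeff (k + 1) - (k + a) * (k + b) * y.coeff k := by
  rw [← Polynomial.coeff_coe, coe_polyHyp, coeff_seriesHyp]; simp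

-- Exchanging the singular points 0 and 1 replaces c by a + b + 1 - c.
open Polynomial in
theorem polyHyp_comp_one_sub (a b c : ℂ) (y : ℂ[X]) :
    polyHyp a b c (y.comp (1 - X)) = (polyHyp a b (a + b + 1 - c) y).comp (1 - X) := by
  simp only [polyHyp, hypOp, Polynomial.algebraMap_eq, Polynomial.derivative'_apply, derivative_comp]
  simp [derivative_comp]
  ring

open Polynomial in
/-- A polynomial solution of degree below the characteristic exponents at infinity vanishes. -/
theorem polyHyp_eq_zero {a b c : ℂ} {N : ℕ} (hab : ∀ k : ℕ, k < N → (k + a) * (k + b) ≠ 0)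
    {y : ℂ[X]} (hy : polyHyp a b c y = 0) (hd : ∀ k, N ≤ k → y.coeff k = 0) : y = 0 := by
  by_contra h0
  have hl : y.coeff y.natDegree ≠ 0 := by simpa using h0
  have hN : y.natDegree < N := by
    by_contra hc
    exact hl (hd _ (not_lt.1 hc))
  -- In the top degree only -(k + a)(k + b) times the leading coefficient survives.
  have := coeff_polyHyp a b c y y.natDegree
  rw [hy, coeff_eq_zero_of_natDegree_lt (Nat.lt_succ_self _)] at this
  simp only [coeff_zero, mul_zero, zero_sub, zero_eq_neg] at this
  exact mul_ne_zero (hab _ hN) hl this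

open Polynomial in
/-- The equation `polyHyp a b c s = g` is triangular below the exponents at infinity. -/
theorem exists_polyHyp_eq {a b c : ℂ} {N : ℕ} (hab : ∀ k : ℕ, k < N → (k + a) * (k + b) ≠ 0) :
    ∀ d ≤ N, ∀ g : ℂ[X], (∀ k, d ≤ k → g.coeff k = 0) →
      ∃ s : ℂ[X], (∀ k, d ≤ k → s.coeff k = 0) ∧ polyHyp a b c s = g := by
  intro d
  induction d with
  | zero =>
    intro _ g hg
    refine ⟨0, by simp, ?_⟩
    ext k
    rw [hg k (Nat.zero_le _), coeff_polyHyp]; simp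
  | succ d ih =>
    intro hd g hg
    have hne := hab d (by omega)
    -- In degree d the operator multiplies X^d by -(d + a)(d + b), so this monomial accounts for the
    -- top coefficient of g.
    set t : ℂ[X] := C (-(g.coeff d / ((d + a) * (d + b)))) * X ^ d with ht
    obtain ⟨s, hs, hs'⟩ := ih (by omega) (g - polyHyp a b c t) (by
      intro k hk
      rw [coeff_sub, coeff_polyHyp, ht, coeff_C_mul, coeff_C_mul, coeff_X_pow, coeff_X_pow,
        if_neg (by omega)]
      rcases hk.eq_or_lt with rfl | hk
      · have h := mul_div_cancel₀ (g.coeff d) hne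
        simp only [if_true]
        linear_combination -h
      · rw [hg k hk, if_neg (by omega)]; ring)
    refine ⟨s + t, ?_, ?_⟩
    · intro k hk
      rw [coeff_add, hs k (by omega), ht, coeff_C_mul, coeff_X_pow, if_neg (by omega)]; simp
    · rw [polyHyp, hypOp_add]
      change polyHyp a b c s + polyHyp a b c t = g
      rw [hs']; ring

open PowerSeries in
/-- A power series solution is determined by its constant coefficient. -/
theorem seriesHyp_eq_zero {a b c : ℂ} (hc : ∀ k : ℕ, (k + c : ℂ) ≠ 0) {y : ℂ⟦X⟧}
    (hy : seriesHyp a b c y = 0) (h0 : coeff 0 y = 0) : y = 0 := by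
  ext k
  induction k with
  | zero => simpa using h0
  | succ k ih =>
    have := coeff_seriesHyp a b c y k
    rw [hy, ih] at this
    have h1 : (k + 1 : ℂ) ≠ 0 := by exact_mod_cast Nat.succ_ne_zero k
    simpa [hc k, h1] using this.symm

end

/-! ### The polynomials behind the finite sums and their equations. -/

noncomputable section

/-- Coefficients of the terminating hypergeometric polynomial with parameters
`-N`, `B + 1`, `1 + m`. -/
def hypCoeff (N B m k : ℕ) : ℂ :=
  (-1) ^ k * (k + B).factorial / (k.factorial * (k + m).factorial)
    * (N.descFactorial k / N.factorial)

theorem hypCoeff_of_le {N B m k : ℕ} (h : k ≤ N) : hypCoeff N B m k =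
    (-1) ^ k * (k + B).factorial / (k.factorial * (k + m).factorial * (N - k).factorial) := by
  have h1 : ((N - k).factorial : ℂ) * N.descFactorial k = N.factorial := by
    exact_mod_cast Nat.factorial_mul_descFactorial h
  have h2 : ((N - k).factorial : ℂ) ≠ 0 := by exact_mod_cast Nat.factorial_ne_zero _
  have h3 : (N.factorial : ℂ) ≠ 0 := by exact_mod_cast Nat.factorial_ne_zero _
  have h4 : (N.descFactorial k / N.factorial : ℂ) = 1 / (N - k).factorial := by
    field_simp; linear_combination h1
  rw [hypCoeff, h4]; ring

theorem hypCoeff_of_lt {N B m k : ℕ} (h : N < k) : hypCoeff N B m k = 0 := by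
  simp [hypCoeff, Nat.descFactorial_eq_zero_iff_lt.2 h]

/-- Holds for all k, also beyond N: the falling factorial in `hypCoeff` vanishes there, which 1/(N -
k)! with truncated subtraction would not do. -/
theorem hypCoeff_succ (N B m k : ℕ) : (k + 1) * (k + 1 + m) * hypCoeff N B m (k + 1) =
    (k - N) * (k + B + 1) * hypCoeff N B m k := by
  have h1 : (N.descFactorial (k + 1) : ℂ) = (N - k) * N.descFactorial k := by
    rw [Nat.descFactorial_succ]
    rcases le_or_gt k N with h | h
    · push_cast [h]; ring
    · simp [Nat.descFactorial_eq_zero_iff_lt.2 h]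
  have h2 : ((k + 1 + m).factorial : ℂ) = (k + 1 + m) * (k + m).factorial := by
    rw [show k + 1 + m = (k + m) + 1 by ring, Nat.factorial_succ]; push_cast; ring
  have h3 : ((k + 1 + B).factorial : ℂ) = (k + B + 1) * (k + B).factorial := by
    rw [show k + 1 + B = (k + B) + 1 by ring, Nat.factorial_succ]; push_cast; ring
  have h4 : ((k + 1).factorial : ℂ) = (k + 1) * k.factorial := by
    rw [Nat.factorial_succ]; push_cast; ring
  have e1 : (k + 1 : ℂ) ≠ 0 := by exact_mod_cast Nat.succ_ne_zero k
  have e2 : (k + 1 + m : ℂ) ≠ 0 := by exact_mod_cast (by omega : k + 1 + m ≠ 0)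
  have e3 : (k.factorial : ℂ) ≠ 0 := by exact_mod_cast Nat.factorial_ne_zero _
  have e4 : ((k + m).factorial : ℂ) ≠ 0 := by exact_mod_cast Nat.factorial_ne_zero _
  have e5 : (N.factorial : ℂ) ≠ 0 := by exact_mod_cast Nat.factorial_ne_zero _
  rw [hypCoeff, hypCoeff, h1, h2, h3, h4, pow_succ]
  field_simp
  ring

open Polynomial

/-- The terminating hypergeometric polynomial, with weighted coefficients. -/
def hypPoly (N B m : ℕ) (θ : ℕ → ℂ) : ℂ[X] :=
  ∑ k ∈ Finset.range (N + 1), C (hypCoeff N B m k * θ k) * X ^ k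

theorem coeff_hypPoly (N B m : ℕ) (θ : ℕ → ℂ) (k : ℕ) :
    (hypPoly N B m θ).coeff k = hypCoeff N B m k * θ k := by
  simp only [hypPoly, finsetSum_coeff, coeff_C_mul, coeff_X_pow, mul_ite, mul_one, mul_zero]
  rw [Finset.sum_ite_eq]
  split_ifs with h
  · rfl
  · rw [hypCoeff_of_lt (by simpa using h), zero_mul]

theorem natDegree_hypPoly_le (N B m : ℕ) (θ : ℕ → ℂ) : (hypPoly N B m θ).natDegree ≤ N := by
  rw [natDegree_le_iff_coeff_eq_zero]
  intro k hk
  rw [coeff_hypPoly, hypCoeff_of_lt hk, zero_mul]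

theorem polyHyp_hypPoly_one (N B m : ℕ) : polyHyp (-N) (B + 1) (1 + m) (hypPoly N B m 1) = 0 := by
  ext k
  rw [coeff_polyHyp, coeff_hypPoly, coeff_hypPoly, coeff_zero]
  simp only [Pi.one_apply]
  linear_combination hypCoeff_succ N B m k

theorem hypPoly_exponents (N B : ℕ) (k : ℕ) (h : k < N) :
    ((k + -N) * (k + (B + 1)) : ℂ) ≠ 0 := by
  refine mul_ne_zero ?_ ?_
  · rw [← sub_eq_add_neg, sub_ne_zero]; exact_mod_cast h.ne
  · exact_mod_cast (by omega : k + (B + 1) ≠ 0)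

theorem natDegree_one_sub_X_le : (1 - X : ℂ[X]).natDegree ≤ 1 := by
  compute_degree

theorem natDegree_one_sub_X_pow_le (m : ℕ) : ((1 - X : ℂ[X]) ^ m).natDegree ≤ m := by
  simpa using natDegree_pow_le_of_le m natDegree_one_sub_X_le

theorem coeff_one_sub_X_pow_self (m : ℕ) : ((1 - X : ℂ[X]) ^ m).coeff m = (-1) ^ m := by
  have := coeff_pow_of_natDegree_le (m := m) natDegree_one_sub_X_le
  rw [mul_one] at this
  rw [this]; simp [coeff_one]

theorem natDegree_comp_one_sub_X_le {N : ℕ} {y : ℂ[X]} (hy : y.natDegree ≤ N) :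
    (y.comp (1 - X)).natDegree ≤ N :=
  natDegree_comp_le.trans ((Nat.mul_le_mul hy natDegree_one_sub_X_le).trans (mul_one N).le)

theorem coeff_comp_one_sub_X {N : ℕ} {y : ℂ[X]} (hy : y.natDegree ≤ N) :
    (y.comp (1 - X)).coeff N = (-1) ^ N * y.coeff N := by
  conv_lhs => rw [y.as_sum_range' (N + 1) (Nat.lt_succ_of_le hy)]
  rw [Finset.sum_range_succ, add_comp, coeff_add, Polynomial.sum_comp, finsetSum_coeff,
    Finset.sum_eq_zero, monomial_comp, coeff_C_mul, coeff_one_sub_X_pow_self, zero_add, mul_comm]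
  intro k hk
  rw [monomial_comp, coeff_C_mul, coeff_eq_zero_of_natDegree_lt
    ((natDegree_one_sub_X_pow_le k).trans_lt (Finset.mem_range.1 hk)), mul_zero]

theorem coeff_eq_zero_of_le {N : ℕ} {y : ℂ[X]} (hy : y.natDegree ≤ N) (h : y.coeff N = 0) :
    ∀ k, N ≤ k → y.coeff k = 0 := by
  intro k hk
  rcases hk.eq_or_lt with rfl | hk
  · exact h
  · exact coeff_eq_zero_of_natDegree_lt (hy.trans_lt hk)

/-- For B = N + 2m the parameters satisfy a + b + 1 = 2c, so the equation is invariant under X ↦ 1 -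
X. The difference of the two sides is a solution of degree below N, hence zero. -/
theorem hypPoly_comp_one_sub (N m : ℕ) : (hypPoly N (N + 2 * m) m 1).comp (1 - X) =
    C ((-1) ^ N) * hypPoly N (N + 2 * m) m 1 := by
  set f := hypPoly N (N + 2 * m) m 1 with hf
  have hd : f.natDegree ≤ N := natDegree_hypPoly_le _ _ _ _
  refine sub_eq_zero.1 (polyHyp_eq_zero (a := -N) (b := (N + 2 * m : ℕ) + 1) (c := 1 + m)
    (hypPoly_exponents N (N + 2 * m)) ?_ (coeff_eq_zero_of_le (N := N) ?_ ?_))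
  · rw [polyHyp, hypOp_sub, ← Polynomial.algebraMap_eq, hypOp_const_mul]
    change polyHyp _ _ _ _ - _ * polyHyp _ _ _ _ = 0
    rw [polyHyp_comp_one_sub, polyHyp_hypPoly_one]
    have : (-N + ((N + 2 * m : ℕ) + 1) + 1 - (1 + m) : ℂ) = 1 + m := by push_cast; ring
    rw [this, polyHyp_hypPoly_one]; simp
  · exact (natDegree_sub_le_of_le (natDegree_comp_one_sub_X_le hd)
      ((natDegree_C_mul_le _ _).trans hd)).trans (max_self N).le
  · rw [coeff_sub, coeff_comp_one_sub_X hd, coeff_C_mul, sub_self]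

variable {n m : ℕ}

/-- The polynomial factor of `P_n^m`, up to sign and algebraic prefactors. -/
def legF (n m : ℕ) (θ : ℕ → ℂ) : ℂ[X] := hypPoly (n - m) (n + m) m θ

/-- The Euler transform of `legF n m 1`, with weighted coefficients. -/
def legR (n m : ℕ) (θ : ℕ → ℂ) : ℂ[X] :=
  C ((n + m).factorial / (n - m).factorial : ℂ) * hypPoly n n m θ

theorem polyHyp_legF (hmn : m ≤ n) :
    polyHyp (m - n) (n + m + 1) (1 + m) (legF n m 1) = 0 := by
  have := polyHyp_hypPoly_one (n - m) (n + m) m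
  push_cast [hmn] at this
  rwa [neg_sub] at this

theorem polyHyp_legR : polyHyp (-n) (n + 1) (1 + m) (legR n m 1) = 0 := by
  rw [legR, ← Polynomial.algebraMap_eq, polyHyp, hypOp_const_mul]
  change _ * polyHyp _ _ _ _ = 0
  rw [polyHyp_hypPoly_one, mul_zero]

theorem natDegree_legR_le (θ : ℕ → ℂ) : (legR n m θ).natDegree ≤ n :=
  (natDegree_C_mul_le _ _).trans (natDegree_hypPoly_le _ _ _ _)

theorem natDegree_legF_le (θ : ℕ → ℂ) : (legF n m θ).natDegree ≤ n - m :=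
  natDegree_hypPoly_le _ _ _ _

theorem legF_top (hmn : m ≤ n) :
    (-1) ^ m * hypCoeff (n - m) (n + m) m (n - m) =
      ((n + m).factorial / (n - m).factorial : ℂ) * hypCoeff n n m n := by
  rw [hypCoeff_of_le le_rfl, hypCoeff_of_le le_rfl]
  obtain ⟨l, rfl⟩ := Nat.exists_eq_add_of_le hmn
  have e4 : ((m + l + m).factorial : ℂ) ≠ 0 := by exact_mod_cast Nat.factorial_ne_zero _
  have e5 : ((m + l).factorial : ℂ) ≠ 0 := by exact_mod_cast Nat.factorial_ne_zero _
  have e6 : (l.factorial : ℂ) ≠ 0 := by exact_mod_cast Nat.factorial_ne_zero _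
  rw [Nat.add_sub_cancel_left, Nat.sub_self, Nat.sub_self, add_comm l m,
    show l + (m + l + m) = m + l + (m + l) by ring, pow_add]
  field_simp

/-- By Euler's transformation both sides solve the same equation. Both have degree at most n and
equal coefficients there (`legF_top`), so the difference lies below the exponent n at infinity. -/
theorem legR_eq (hmn : m ≤ n) : legR n m 1 = (1 - X) ^ m * legF n m 1 := by
  refine (sub_eq_zero.1 (polyHyp_eq_zero (a := -n) (b := n + 1) (c := 1 + m)
    (hypPoly_exponents n n) ?_ (coeff_eq_zero_of_le (N := n) ?_ ?_)))
  · rw [polyHyp, hypOp_sub]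
    change polyHyp _ _ _ _ - _ = 0
    rw [polyHyp_legR]
    have h := hypOp_one_sub_pow_mul derivative' (x := (X : ℂ[X])) (by simp)
      (a := n + m + 1) (b := m - n) (c := 1 + m) m (by ring) (legF n m 1)
    rw [hypOp_swap _ (n + m + 1 : ℂ)] at h
    have h' := polyHyp_legF hmn
    rw [polyHyp] at h'
    rw [h', mul_zero] at h
    rw [zero_sub, neg_eq_zero]
    convert h using 2 <;> ring
  · refine (natDegree_sub_le_of_le (natDegree_legR_le _) ?_).trans (max_self n).le
    exact (natDegree_mul_le_of_le (natDegree_one_sub_X_pow_le m) (natDegree_legF_le 1)).trans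
      (by omega)
  · have h := coeff_mul_add_eq_of_natDegree_le (natDegree_one_sub_X_pow_le m)
      (natDegree_legF_le (n := n) (m := m) 1)
    rw [show m + (n - m) = n by omega] at h
    rw [coeff_sub, h, coeff_one_sub_X_pow_self, legR, coeff_C_mul, coeff_hypPoly, legF,
      coeff_hypPoly]
    simp only [Pi.one_apply, mul_one]
    rw [legF_top hmn, sub_self]

theorem legF_comp (hmn : m ≤ n) :
    (legF n m 1).comp (1 - X) = C ((-1) ^ (n + m)) * legF n m 1 := by
  have h := hypPoly_comp_one_sub (n - m) m
  rw [show n - m + 2 * m = n + m by omega] at h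
  have e : ((-1) ^ (n + m) : ℂ) = (-1) ^ (n - m) := by
    rw [show n + m = (n - m) + 2 * m by omega, pow_add, pow_mul]; simp
  rw [legF, h, e]

/-- Weighting a solution of the recursion leaves (k + 1)(k + 1 + m)(θ(k+1) - θ(k)) times the next
coefficient. The denominators of the difference cancel against the recursion, and what remains is a
first-order operator applied to the unweighted polynomial. -/
theorem polyHyp_legF_weighted (hmn : m ≤ n) {θ : ℕ → ℂ}
    (hθ : ∀ k : ℕ, θ (k + 1) - θ k = 2 / (k + n + m + 1) - 1 / (k + m + 1)) :
    polyHyp (m - n) (n + m + 1) (1 + m) (legF n m θ) =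
      2 * (X * derivative (legF n m 1) - C (n - m : ℂ) * legF n m 1)
        - derivative (legF n m 1) := by
  ext k
  have e1 : (k + n + m + 1 : ℂ) ≠ 0 := by exact_mod_cast Nat.succ_ne_zero (k + n + m)
  have e2 : (k + m + 1 : ℂ) ≠ 0 := by exact_mod_cast Nat.succ_ne_zero (k + m)
  have hr := hypCoeff_succ (n - m) (n + m) m k
  push_cast [hmn] at hr
  have hX : (X * derivative (legF n m 1)).coeff k = k * (legF n m 1).coeff k := by
    cases k with
    | zero => simp
    | succ k => rw [coeff_X_mul, coeff_derivative]; push_cast; ring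
  rw [coeff_polyHyp, coeff_sub, ← C_ofNat, coeff_C_mul, coeff_sub, coeff_C_mul, hX,
    coeff_derivative, legF, legF, coeff_hypPoly, coeff_hypPoly, coeff_hypPoly, coeff_hypPoly]
  have := hθ k
  rw [show θ (k + 1) = θ k + 2 / (k + n + m + 1) - 1 / (k + m + 1) by linear_combination this]
  simp only [Pi.one_apply, mul_one]
  generalize hypCoeff (n - m) (n + m) m (k + 1) = A at *
  generalize hypCoeff (n - m) (n + m) m k = D at *
  have hA : A = (k - (n - m)) * (k + (n + m) + 1) * D / ((k + 1) * (k + m + 1)) := by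
    have e3 : (k + 1 : ℂ) ≠ 0 := by exact_mod_cast Nat.succ_ne_zero k
    rw [eq_div_iff (mul_ne_zero e3 e2)]; linear_combination hr
  have e3 : (k + 1 : ℂ) ≠ 0 := by exact_mod_cast Nat.succ_ne_zero k
  rw [hA]
  field_simp
  ring

/-- As for `legF`, but the difference 1/(k + 1) leaves m times the shifted coefficient. Undoing the
shift costs the factor X and the constant term, and that constant term is what `legSing`
compensates. -/
theorem polyHyp_legR_weighted {φ : ℕ → ℂ}
    (hφ : ∀ k : ℕ, φ (k + 1) - φ k = 2 / (k + n + 1) - 2 / (k + m + 1) - 1 / (k + 1)) :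
    X * polyHyp (-n) (n + 1) (1 + m) (legR n m φ) =
      X * (2 * (X * derivative (legR n m 1) - C (n : ℂ) * legR n m 1)
        - 3 * derivative (legR n m 1))
        - C (m : ℂ) * (legR n m 1 - C ((legR n m 1).coeff 0)) := by
  ext j
  cases j with
  | zero => simp
  | succ k =>
  have e1 : (k + n + 1 : ℂ) ≠ 0 := by exact_mod_cast Nat.succ_ne_zero (k + n)
  have e2 : (k + m + 1 : ℂ) ≠ 0 := by exact_mod_cast Nat.succ_ne_zero (k + m)
  have e3 : (k + 1 : ℂ) ≠ 0 := by exact_mod_cast Nat.succ_ne_zero k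
  have hr := hypCoeff_succ n n m k
  have hX : (X * derivative (legR n m 1)).coeff k = k * (legR n m 1).coeff k := by
    cases k with
    | zero => simp
    | succ k => rw [coeff_X_mul, coeff_derivative]; push_cast; ring
  rw [coeff_X_mul, coeff_polyHyp, coeff_sub, coeff_X_mul, coeff_sub, ← C_ofNat, ← C_ofNat,
    coeff_C_mul, coeff_sub, coeff_C_mul, hX,
    coeff_C_mul, coeff_derivative, coeff_C_mul, coeff_sub, coeff_C_succ, legR, legR,
    coeff_C_mul, coeff_C_mul, coeff_C_mul, coeff_C_mul,
    coeff_hypPoly, coeff_hypPoly, coeff_hypPoly, coeff_hypPoly]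
  have := hφ k
  rw [show φ (k + 1) = φ k + 2 / (k + n + 1) - 2 / (k + m + 1) - 1 / (k + 1) by
    linear_combination this]
  simp only [Pi.one_apply, mul_one]
  generalize ((n + m).factorial / (n - m).factorial : ℂ) = κ
  generalize hypCoeff n n m (k + 1) = A at *
  generalize hypCoeff n n m k = D at *
  have hA : A = (k - n) * (k + n + 1) * D / ((k + 1) * (k + m + 1)) := by
    rw [eq_div_iff (mul_ne_zero e3 e2)]; linear_combination hr
  rw [hA]
  field_simp
  ring

/-- The finite sum carrying the poles at `w = 1`. -/
def legSing (n m : ℕ) : ℂ[X] :=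
  ∑ k ∈ Finset.range m, C (((n + m).factorial / (n - m).factorial : ℂ) *
    (((k + n - m).factorial * (m - k - 1).factorial : ℂ)
      / (k.factorial * (n + m - k).factorial : ℂ))) * X ^ k

theorem coeff_legSing (n m k : ℕ) : (legSing n m).coeff k =
    if k < m then ((n + m).factorial / (n - m).factorial : ℂ) *
      (((k + n - m).factorial * (m - k - 1).factorial : ℂ)
        / (k.factorial * (n + m - k).factorial : ℂ)) else 0 := by
  simp only [legSing, finsetSum_coeff, coeff_C_mul, coeff_X_pow, mul_ite, mul_one, mul_zero]
  rw [Finset.sum_ite_eq]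
  simp

theorem coeff_zero_legR : (legR n m 1).coeff 0 =
    ((n + m).factorial / (n - m).factorial : ℂ) / m.factorial := by
  have e : (n.factorial : ℂ) ≠ 0 := by exact_mod_cast Nat.factorial_ne_zero _
  rw [legR, coeff_C_mul, coeff_hypPoly, hypCoeff_of_le (Nat.zero_le _)]
  simp
  field_simp

/-- The coefficients obey the recursion except at the cut-off k = m - 1, where k + c = 0 and the
last coefficient alone contributes. The factor X avoids writing X^(m-1). -/
theorem X_mul_polyHyp_legSing (hmn : m ≤ n) :
    X * polyHyp (1 - m + n) (-m - n) (1 - m) (legSing n m) =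
      C (m * (legR n m 1).coeff 0) * X ^ m := by
  ext j
  cases j with
  | zero =>
    cases m with
    | zero => simp
    | succ m => simp
  | succ k =>
  rw [coeff_X_mul, coeff_polyHyp, coeff_legSing, coeff_legSing, coeff_C_mul, coeff_X_pow,
    coeff_zero_legR]
  generalize ((n + m).factorial / (n - m).factorial : ℂ) = κ
  rcases lt_trichotomy (k + 1) m with h | h | h
  · rw [if_pos h, if_pos (by omega), if_neg (by omega)]
    obtain ⟨i, rfl⟩ : ∃ i, m = k + 2 + i := ⟨m - k - 2, by omega⟩
    obtain ⟨l, rfl⟩ := Nat.exists_eq_add_of_le hmn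
    rw [show k + 1 + (k + 2 + i + l) - (k + 2 + i) = k + l + 1 by omega,
      show k + (k + 2 + i + l) - (k + 2 + i) = k + l by omega,
      show k + 2 + i - (k + 1) - 1 = i by omega, show k + 2 + i - k - 1 = i + 1 by omega,
      show k + 2 + i + l + (k + 2 + i) - (k + 1) = k + 2 + i + i + l + 1 by omega,
      show k + 2 + i + l + (k + 2 + i) - k = (k + 2 + i + i + l + 1) + 1 by omega]
    rw [Nat.factorial_succ k, Nat.factorial_succ i, Nat.factorial_succ (k + l),
      Nat.factorial_succ (k + 2 + i + i + l + 1)]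
    have e1 : (k.factorial : ℂ) ≠ 0 := by exact_mod_cast Nat.factorial_ne_zero _
    have e2 : ((k + 2 + i + i + l + 1).factorial : ℂ) ≠ 0 := by
      exact_mod_cast Nat.factorial_ne_zero _
    have e3 : (k + 1 : ℂ) ≠ 0 := by exact_mod_cast Nat.succ_ne_zero k
    have e4 : (k + 2 + i + i + l + 1 + 1 : ℂ) ≠ 0 := by
      exact_mod_cast Nat.succ_ne_zero (k + 2 + i + i + l + 1)
    push_cast
    field_simp
    ring
  · rw [if_neg (by omega), if_pos (by omega), if_pos h]
    subst h
    obtain ⟨l, rfl⟩ := Nat.exists_eq_add_of_le hmn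
    rw [show k + (k + 1 + l) - (k + 1) = k + l by omega,
      show k + 1 - k - 1 = 0 by omega,
      show k + 1 + l + (k + 1) - k = (k + l + 1) + 1 by omega, Nat.factorial_succ (k + l + 1),
      Nat.factorial_succ (k + l), Nat.factorial_succ k]
    have e1 : (k.factorial : ℂ) ≠ 0 := by exact_mod_cast Nat.factorial_ne_zero _
    have e2 : ((k + l).factorial : ℂ) ≠ 0 := by exact_mod_cast Nat.factorial_ne_zero _
    have e3 : (k + 1 : ℂ) ≠ 0 := by exact_mod_cast Nat.succ_ne_zero k
    have e4 : (k + l + 1 : ℂ) ≠ 0 := by exact_mod_cast Nat.succ_ne_zero (k + l)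
    have e5 : (k + l + 1 + 1 : ℂ) ≠ 0 := by exact_mod_cast Nat.succ_ne_zero (k + l + 1)
    push_cast [Nat.factorial_zero]
    field_simp
    ring
  · rw [if_neg (by omega), if_neg (by omega), if_neg (by omega)]; ring

end

/-! ### The implicit polynomial s and the polynomial identity. -/

noncomputable section
open Polynomial
variable {n m : ℕ}

/-- `s` is a polynomial of degree at most `n` such that `legR * log (1 - w) + s` solves the
inhomogeneous equation satisfied by the derivative in the degree. -/
structure IsLegS (n m : ℕ) (s : ℂ[X]) : Prop where
  natDegree_le : s.natDegree ≤ n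
  ode : (1 - X) * polyHyp (-n) (n + 1) (1 + m) s =
    2 * (1 - X) * (X * derivative (legR n m 1) - C (n : ℂ) * legR n m 1) + C (m : ℂ) * legR n m 1

/-- The equation can be divided by 1 - X, because m r is divisible by it: m = 0 kills the term, and
otherwise r contains (1 - X)^m. The resulting right-hand side has degree below n since X d/dX - n
annihilates degree n, so the triangular solver applies. -/
theorem exists_isLegS (hmn : m ≤ n) : ∃ s, IsLegS n m s := by
  obtain ⟨q, hq, hqd⟩ : ∃ q : ℂ[X], (1 - X) * q = C (m : ℂ) * legR n m 1 ∧
      ∀ k, n ≤ k → q.coeff k = 0 := by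
    rcases m with _ | m
    · exact ⟨0, by simp, by simp⟩
    · refine ⟨C ((m + 1 : ℕ) : ℂ) * ((1 - X) ^ m * legF n (m + 1) 1), ?_, ?_⟩
      · rw [legR_eq hmn]; ring
      · intro k hk
        rw [coeff_C_mul, coeff_eq_zero_of_natDegree_lt, mul_zero]
        exact (natDegree_mul_le_of_le (natDegree_one_sub_X_pow_le m)
          (natDegree_legF_le 1)).trans_lt (by omega)
  obtain ⟨s, hs, hs'⟩ := exists_polyHyp_eq (c := 1 + m) (hypPoly_exponents n n) n le_rfl
    (2 * (X * derivative (legR n m 1) - C (n : ℂ) * legR n m 1) + q) (by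
      have hX : ∀ k, (X * derivative (legR n m 1)).coeff k = k * (legR n m 1).coeff k := by
        intro k
        cases k with
        | zero => simp
        | succ k => rw [coeff_X_mul, coeff_derivative]; push_cast; ring
      intro k hk
      rw [coeff_add, hqd k hk, ← C_ofNat, coeff_C_mul, coeff_sub, coeff_C_mul, hX]
      rcases hk.eq_or_lt with rfl | hk
      · ring
      · rw [coeff_eq_zero_of_natDegree_lt ((natDegree_legR_le 1).trans_lt hk)]; ring)
  refine ⟨s, natDegree_le_iff_coeff_eq_zero.2 fun k hk => hs k hk.le, ?_⟩
  rw [hs', mul_add, hq]; ring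

/-- The polynomial r solves the homogeneous equation; this freedom is later used to prescribe the
constant coefficient of s. -/
theorem IsLegS.add_const_mul {s : ℂ[X]} (hs : IsLegS n m s) (t : ℂ) :
    IsLegS n m (s + C t * legR n m 1) := by
  refine ⟨(natDegree_add_le _ _).trans (max_le hs.natDegree_le
    ((natDegree_C_mul_le _ _).trans (natDegree_legR_le 1))), ?_⟩
  rw [← hs.ode, polyHyp, hypOp_add, ← Polynomial.algebraMap_eq, hypOp_const_mul]
  have := polyHyp_legR (n := n) (m := m)
  rw [polyHyp] at this
  rw [this, mul_zero, add_zero]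

theorem exists_isLegS_coeff_zero (hmn : m ≤ n) (d : ℂ) : ∃ s, IsLegS n m s ∧ s.coeff 0 = d := by
  obtain ⟨s, hs⟩ := exists_isLegS hmn
  refine ⟨_, hs.add_const_mul ((d - s.coeff 0) / (legR n m 1).coeff 0), ?_⟩
  have : (legR n m 1).coeff 0 ≠ 0 := by
    rw [coeff_zero_legR]
    have h (k : ℕ) : (k.factorial : ℂ) ≠ 0 := by exact_mod_cast Nat.factorial_ne_zero _
    exact div_ne_zero (div_ne_zero (h _) (h _)) (h _)
  rw [coeff_add, coeff_C_mul, div_mul_cancel₀ _ this]; ring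

theorem derivative_legR (hmn : m ≤ n) : (1 - X) * derivative (legR n m 1) =
    (1 - X) ^ m * ((1 - X) * derivative (legF n m 1) - C (m : ℂ) * legF n m 1) := by
  have h := one_sub_mul_derivation_pow derivative' (x := (X : ℂ[X])) (by simp) m
  rw [derivative'_apply] at h
  rw [legR_eq hmn, derivative_mul]
  simp only [C_eq_natCast]
  linear_combination legF n m 1 * h

/-- The ψ term is a homogeneous solution and drops out. The defect left by the constant term of
`legR` cancels against that of `legSing`. -/
theorem legF_combination_left (hmn : m ≤ n) {θ φ : ℕ → ℂ} {ψ : ℂ}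
    (hθ : ∀ k : ℕ, θ (k + 1) - θ k = 2 / (k + n + m + 1) - 1 / (k + m + 1))
    (hφ : ∀ k : ℕ, φ (k + 1) - φ k = 2 / (k + n + 1) - 2 / (k + m + 1) - 1 / (k + 1)) :
    X * (1 - X) * polyHyp (1 - m + n) (-m - n) (1 - m)
      (X ^ m * (1 - X) ^ m * (legF n m θ - C ψ * legF n m 1) - X ^ m * legR n m φ + legSing n m) =
    X ^ m * (1 - X) ^ m * (2 * X * (1 - X) * derivative (legF n m 1)
      + C (m : ℂ) * (1 - 2 * X) * legF n m 1) := by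
  have hz (y : ℂ[X]) : polyHyp (1 - m + n) (-m - n) (1 - m) (X ^ m * y) =
      X ^ m * polyHyp (-n) (n + 1) (1 + m) y := by
    rw [polyHyp, hypOp_pow_mul _ (by simp), hypOp_swap]; congr 2 <;> ring
  have hu (y : ℂ[X]) : polyHyp (-n) (n + 1) (1 + m) ((1 - X) ^ m * y) =
      (1 - X) ^ m * polyHyp (m - n) (n + m + 1) (1 + m) y := by
    have h := hypOp_one_sub_pow_mul derivative' (x := (X : ℂ[X])) (by simp)
      (a := n + m + 1) (b := m - n) (c := 1 + m) m (by ring) y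
    rw [hypOp_swap _ (n + m + 1 : ℂ)] at h
    rw [polyHyp, ← h]; congr 1 <;> ring
  have h1 := polyHyp_legF_weighted hmn hθ
  have h2 := polyHyp_legR_weighted (m := m) hφ
  have h3 := X_mul_polyHyp_legSing hmn
  have h4 := derivative_legR hmn
  have h5 := legR_eq hmn
  have h6 : polyHyp (m - n) (n + m + 1) (1 + m) (legF n m θ - C ψ * legF n m 1) =
      polyHyp (m - n) (n + m + 1) (1 + m) (legF n m θ) := by
    rw [polyHyp, hypOp_sub, ← Polynomial.algebraMap_eq, hypOp_const_mul]
    have := polyHyp_legF hmn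
    rw [polyHyp] at this
    rw [this, mul_zero, sub_zero]
  have h7 : polyHyp (1 - m + n) (-m - n) (1 - m)
      (X ^ m * (1 - X) ^ m * (legF n m θ - C ψ * legF n m 1) - X ^ m * legR n m φ + legSing n m) =
      X ^ m * ((1 - X) ^ m * polyHyp (m - n) (n + m + 1) (1 + m) (legF n m θ))
      - X ^ m * polyHyp (-n) (n + 1) (1 + m) (legR n m φ)
      + polyHyp (1 - m + n) (-m - n) (1 - m) (legSing n m) := by
    rw [← h6, ← hu, ← hz, ← hz, polyHyp, hypOp_add, hypOp_sub, mul_assoc]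
  rw [h7, h1]
  rw [h5] at h2 h3 h4
  simp only [C_mul, C_sub] at h2 h3 ⊢
  generalize polyHyp (-n) (n + 1) (1 + m) (legR n m φ) = V at *
  generalize polyHyp (1 - m + n) (-m - n) (1 - m) (legSing n m) = S at *
  generalize derivative ((1 - X) ^ m * legF n m 1) = r' at *
  linear_combination (-(1 - X) * X ^ m) * h2 + (1 - X) * h3 - X ^ m * X * (2 * X - 3) * h4

/-- With g = w^m (1 - w)^m `legF`, the function g log((1 - w)/w) plus this combination is a
homogeneous solution: the two terms with s come from solutions exchanged by w ↦ 1 - w. The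
right-hand side is therefore minus w(1 - w) times the operator applied to g log((1 - w)/w). -/
theorem legF_combination_right (hmn : m ≤ n) {s : ℂ[X]} (hs : IsLegS n m s) :
    X * (1 - X) * polyHyp (1 - m + n) (-m - n) (1 - m)
      (X ^ m * s - C ((-1) ^ (n + m)) * ((1 - X) ^ m * s.comp (1 - X))) =
    X ^ m * (1 - X) ^ m * (2 * X * (1 - X) * derivative (legF n m 1)
      + C (m : ℂ) * (1 - 2 * X) * legF n m 1) := by
  have hz (y : ℂ[X]) : polyHyp (1 - m + n) (-m - n) (1 - m) (X ^ m * y) =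
      X ^ m * polyHyp (-n) (n + 1) (1 + m) y := by
    rw [polyHyp, hypOp_pow_mul _ (by simp), hypOp_swap]; congr 2 <;> ring
  have hu (y : ℂ[X]) : polyHyp (1 - m + n) (-m - n) (1 - m) ((1 - X) ^ m * y) =
      (1 - X) ^ m * polyHyp (-n) (n + 1) (1 - m) y := by
    have h := hypOp_one_sub_pow_mul derivative' (x := (X : ℂ[X])) (by simp)
      (a := -n) (b := n + 1) (c := 1 - m) m (by ring) y
    rw [polyHyp, ← h]; congr 1 <;> ring
  have hr : polyHyp (-n) (n + 1) (1 - m) (s.comp (1 - X)) =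
      (polyHyp (-n) (n + 1) (1 + m) s).comp (1 - X) := by
    rw [polyHyp_comp_one_sub]; congr 2; ring
  have h1 := congrArg (fun p : ℂ[X] => p.comp (1 - X)) hs.ode
  have h2 := congrArg (fun p : ℂ[X] => p.comp (1 - X)) (derivative_legR hmn)
  have h3 := congrArg derivative (legF_comp hmn)
  rw [derivative_comp, derivative_C_mul, derivative_sub, derivative_one, derivative_X] at h3
  have h4 := legF_comp hmn
  have h5 := congrArg (fun p : ℂ[X] => p.comp (1 - X)) (legR_eq hmn)
  have h6 := hs.ode
  have h7 := derivative_legR hmn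
  have h8 := legR_eq hmn
  have hσ : (C ((-1) ^ (n + m)) : ℂ[X]) * C ((-1) ^ (n + m)) = 1 := by
    rw [← C_mul, ← pow_add, ← two_mul, pow_mul]; simp
  have hlin : polyHyp (1 - m + n) (-m - n) (1 - m)
      (X ^ m * s - C ((-1) ^ (n + m)) * ((1 - X) ^ m * s.comp (1 - X))) =
      X ^ m * polyHyp (-n) (n + 1) (1 + m) s
        - C ((-1) ^ (n + m)) * ((1 - X) ^ m * (polyHyp (-n) (n + 1) (1 + m) s).comp (1 - X)) := by
    rw [← hr, ← hu, ← hz, polyHyp, hypOp_sub, ← Polynomial.algebraMap_eq, hypOp_const_mul]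
  rw [hlin]
  simp only [mul_comp, sub_comp, add_comp, X_comp, one_comp, C_comp, ofNat_comp, pow_comp,
    h4, sub_sub_cancel, Nat.cast_ofNat] at h1 h2 h5
  rw [h5] at h1
  generalize (C ((-1) ^ (n + m)) : ℂ[X]) = σ at *
  generalize (polyHyp (-n) (n + 1) (1 + m) s).comp (1 - X) = V at *
  generalize polyHyp (-n) (n + 1) (1 + m) s = S at *
  generalize (derivative (legR n m 1)).comp (1 - X) = r'c at *
  generalize (derivative (legF n m 1)).comp (1 - X) = f'c at *
  generalize derivative (legR n m 1) = r' at *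
  rw [h8] at h6
  generalize derivative (legF n m 1) = f' at *
  generalize legF n m 1 = f at *
  have h3' : f'c = -σ * f' := by linear_combination -h3
  rw [h3'] at h2
  generalize (1 - X : ℂ[X]) ^ m = u at *
  generalize hw : (X : ℂ[X]) ^ m = w at *
  linear_combination (X * w) * h6 + (2 * X ^ 2 * w) * h7 - σ * u * (1 - X) * h1
    - 2 * σ * u * (1 - X) ^ 2 * h2
    + (2 * (1 - X) ^ 2 * u * w * (X * f' + C (m : ℂ) * f)
      + 2 * C (n : ℂ) * u * w * X * (1 - X) * f - C (m : ℂ) * u * w * (1 - X) * f) * hσ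

/-- The polynomial identity behind the finite expansion of `Q_n^m`. -/
theorem legF_combination (hmn : m ≤ n) {s : ℂ[X]} (hs : IsLegS n m s) {θ φ : ℕ → ℂ} {ψ : ℂ}
    (hθ : ∀ k : ℕ, θ (k + 1) - θ k = 2 / (k + n + m + 1) - 1 / (k + m + 1))
    (hφ : ∀ k : ℕ, φ (k + 1) - φ k = 2 / (k + n + 1) - 2 / (k + m + 1) - 1 / (k + 1))
    (hψ : θ (n - m) - φ n = ψ) :
    X ^ m * (1 - X) ^ m * (legF n m θ - C ψ * legF n m 1) - X ^ m * legR n m φ + legSing n m =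
      X ^ m * s - C ((-1) ^ (n + m)) * ((1 - X) ^ m * s.comp (1 - X)) := by
  have hX : (X * (1 - X) : ℂ[X]) ≠ 0 := by
    refine mul_ne_zero X_ne_zero fun h => ?_
    simpa using congrArg (eval 0) h
  have hS : (legSing n m).natDegree ≤ n + m := by
    rw [natDegree_le_iff_coeff_eq_zero]
    intro k hk
    rw [coeff_legSing, if_neg (by omega)]
  have hS' : (legSing n m).coeff (n + m) = 0 := by
    rw [coeff_legSing, if_neg (by omega)]
  have hXm : (X ^ m : ℂ[X]).natDegree ≤ m := natDegree_X_pow_le m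
  have hF : ((1 - X) ^ m * (legF n m θ - C ψ * legF n m 1)).natDegree ≤ n :=
    (natDegree_mul_le_of_le (natDegree_one_sub_X_pow_le m)
      (natDegree_sub_le_of_le (natDegree_legF_le θ)
        ((natDegree_C_mul_le _ _).trans (natDegree_legF_le 1)))).trans (by omega)
  -- The only use of the boundary relation: ψ is the constant that makes the top coefficients of the
  -- two weighted sums agree.
  have hF' : ((1 - X) ^ m * (legF n m θ - C ψ * legF n m 1)).coeff n =
      (legR n m φ).coeff n := by
    have h := coeff_mul_add_eq_of_natDegree_le (natDegree_one_sub_X_pow_le m)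
      (natDegree_sub_le_of_le (natDegree_legF_le (n := n) (m := m) θ)
        ((natDegree_C_mul_le ψ _).trans (natDegree_legF_le (n := n) (m := m) 1)))
    rw [max_self, show m + (n - m) = n by omega] at h
    rw [h, coeff_one_sub_X_pow_self, legR, coeff_C_mul, coeff_hypPoly, legF, legF, coeff_sub,
      coeff_C_mul, coeff_hypPoly, coeff_hypPoly, ← mul_assoc _ _ (φ n), ← legF_top hmn, ← hψ]
    simp only [Pi.one_apply]
    ring
  have hL : (X ^ m * (1 - X) ^ m * (legF n m θ - C ψ * legF n m 1) - X ^ m * legR n m φ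
      + legSing n m).natDegree ≤ n + m := by
    rw [mul_assoc, ← mul_sub]
    refine natDegree_add_le_of_degree_le ?_ hS
    rw [add_comm n m]
    exact natDegree_mul_le_of_le hXm
      ((natDegree_sub_le_of_le hF (natDegree_legR_le φ)).trans (max_self n).le)
  have hR1 : (X ^ m * s).natDegree ≤ n + m := by
    rw [add_comm n m]; exact natDegree_mul_le_of_le hXm hs.natDegree_le
  have hR2 : ((1 - X) ^ m * s.comp (1 - X)).natDegree ≤ n + m := by
    rw [add_comm n m]
    exact natDegree_mul_le_of_le (natDegree_one_sub_X_pow_le m)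
      (natDegree_comp_one_sub_X_le hs.natDegree_le)
  have hR : (X ^ m * s - C ((-1) ^ (n + m)) * ((1 - X) ^ m * s.comp (1 - X))).natDegree ≤ n + m :=
    (natDegree_sub_le_of_le hR1 ((natDegree_C_mul_le _ _).trans hR2)).trans (max_self _).le
  -- The only natural k with (k + 1 - m + n)(k - m - n) = 0 is n + m, so the coefficient in that
  -- degree has to be compared by hand.
  refine sub_eq_zero.1 (polyHyp_eq_zero (a := 1 - m + n) (b := -m - n) (c := 1 - m) (N := n + m)
    ?_ ?_ (coeff_eq_zero_of_le (N := n + m)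
      ((natDegree_sub_le_of_le hL hR).trans (max_self _).le) ?_))
  · intro k hk
    obtain ⟨l, rfl⟩ := Nat.exists_eq_add_of_le hmn
    refine mul_ne_zero ?_ ?_
    · have : (k + (1 - m + (m + l : ℕ)) : ℂ) = (k + l + 1 : ℕ) := by push_cast; ring
      rw [this]; exact_mod_cast Nat.succ_ne_zero (k + l)
    · have : (k + (-m - (m + l : ℕ)) : ℂ) = k - ((m + l + m : ℕ) : ℂ) := by push_cast; ring
      rw [this, sub_ne_zero]; exact_mod_cast hk.ne
  · rw [polyHyp, hypOp_sub]
    refine mul_left_cancel₀ hX ?_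
    rw [mul_sub, mul_zero, sub_eq_zero]
    exact (legF_combination_left hmn hθ hφ).trans (legF_combination_right hmn hs).symm
  · have h2 := coeff_mul_add_eq_of_natDegree_le (natDegree_one_sub_X_pow_le m)
      (natDegree_comp_one_sub_X_le hs.natDegree_le)
    rw [coeff_comp_one_sub_X hs.natDegree_le, coeff_one_sub_X_pow_self, add_comm m n] at h2
    rw [coeff_sub, coeff_add, coeff_sub, coeff_sub, hS', mul_assoc, coeff_X_pow_mul,
      coeff_X_pow_mul, coeff_X_pow_mul, hF', coeff_C_mul, h2]
    have : ((-1) ^ (n + m) : ℂ) * ((-1) ^ m * (-1) ^ n) = 1 := by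
      rw [← pow_add, ← pow_add, show n + m + (m + n) = 2 * (n + m) by ring, pow_mul]; simp
    linear_combination s.coeff n * this

/-! ### Power series solutions with a logarithm at 1. -/

section Log

/-- The power series of `log (1 - X)`. -/
def logSeries : PowerSeries ℂ := PowerSeries.mk fun k => -(1 / k : ℂ)

theorem one_sub_X_mul_derivative_logSeries :
    (1 - PowerSeries.X) * PowerSeries.derivative ℂ logSeries = -1 := by
  have : PowerSeries.derivative ℂ logSeries = PowerSeries.mk fun _ => (-1 : ℂ) := by
    ext k
    have e3 : (k + 1 : ℂ) ≠ 0 := by exact_mod_cast Nat.succ_ne_zero k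
    rw [PowerSeries.coeff_derivative, logSeries, PowerSeries.coeff_mk, PowerSeries.coeff_mk]
    push_cast; field_simp
  rw [this]
  ext k
  rw [sub_mul, one_mul, map_sub, PowerSeries.coeff_mk]
  cases k with
  | zero => simp
  | succ k => rw [PowerSeries.coeff_succ_X_mul, PowerSeries.coeff_mk]; simp [PowerSeries.coeff_one]

/-- Power series solutions of the inhomogeneous equation contain a logarithm only through
`log (1 - X)`. -/
theorem exists_eq_log_add (hmn : m ≤ n) {D : PowerSeries ℂ}
    (hD : seriesHyp (m - n) (n + m + 1) (1 + m) D =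
      -(2 * n + 1) * (legF n m 1 : PowerSeries ℂ)) :
    ∃ s, IsLegS n m s ∧ (1 - PowerSeries.X) ^ m * D =
      (legR n m 1 : PowerSeries ℂ) * logSeries + (s : PowerSeries ℂ) := by
  -- Since k + 1 + m never vanishes, a series solution is determined by its constant coefficient; s
  -- is chosen to match it.
  obtain ⟨s, hs, hs0⟩ := exists_isLegS_coeff_zero hmn
    (PowerSeries.coeff 0 ((1 - PowerSeries.X) ^ m * D))
  refine ⟨s, hs, sub_eq_zero.1 (seriesHyp_eq_zero (a := -n) (b := n + 1) (c := 1 + m) ?_ ?_ ?_)⟩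
  · intro k
    exact_mod_cast (by omega : k + (1 + m) ≠ 0)
  · have hX : (1 - PowerSeries.X : PowerSeries ℂ) ≠ 0 := fun h => by
      simpa using congrArg (PowerSeries.coeff 0) h
    refine mul_left_cancel₀ hX ?_
    have hu : seriesHyp (-n) (n + 1) (1 + m) ((1 - PowerSeries.X) ^ m * D) =
        (1 - PowerSeries.X) ^ m * seriesHyp (m - n) (n + m + 1) (1 + m) D := by
      have h := hypOp_one_sub_pow_mul (PowerSeries.derivative ℂ) (x := (PowerSeries.X))
        (PowerSeries.derivative_X) (a := n + m + 1) (b := m - n) (c := 1 + m) m (by ring) D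
      rw [hypOp_swap _ (n + m + 1 : ℂ)] at h
      rw [seriesHyp, ← h]; congr 1 <;> ring
    have h1 := congrArg (fun p : ℂ[X] => (p : PowerSeries ℂ)) hs.ode
    have h2 : seriesHyp (-n) (n + 1) (1 + m) (legR n m 1 : PowerSeries ℂ) = 0 := by
      rw [← coe_polyHyp, polyHyp_legR, coe_zero]
    have h3 := one_sub_X_mul_derivative_logSeries
    have h4 := congrArg (PowerSeries.derivative ℂ) h3
    have h5 := congrArg (fun p : ℂ[X] => (p : PowerSeries ℂ)) (legR_eq hmn)
    simp only [coe_mul, coe_sub, coe_add, coe_one, coe_X, coe_C, coe_pow, coe_polyHyp,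
      ← PowerSeries.derivative_coe, ← C_ofNat] at h1 h5
    simp only [Derivation.leibniz, map_sub, map_neg, Derivation.map_one_eq_zero,
      PowerSeries.derivative_X, smul_eq_mul] at h4
    rw [seriesHyp, hypOp_sub, hypOp_add]
    change _ * (seriesHyp _ _ _ _ - (_ + seriesHyp _ _ _ _)) = _
    rw [hu, hD]
    simp only [seriesHyp, hypOp, PowerSeries.algebraMap_eq, Derivation.leibniz, map_add, map_mul,
      map_neg, smul_eq_mul, map_natCast, map_one, map_ofNat] at h1 h2 ⊢
    generalize (legR n m 1 : PowerSeries ℂ) = r at *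
    generalize (legF n m 1 : PowerSeries ℂ) = f at *
    generalize logSeries = L at *
    have h4' : (1 - PowerSeries.X) * PowerSeries.derivative ℂ (PowerSeries.derivative ℂ L) =
      PowerSeries.derivative ℂ L := by linear_combination h4
    linear_combination -h1 - (1 - PowerSeries.X) * L * h2
      - (2 * (1 - PowerSeries.X) * PowerSeries.X * PowerSeries.derivative ℂ r
        + (1 + m - PowerSeries.X) * r) * h3
      - (1 - PowerSeries.X) * PowerSeries.X * r * h4'
      + (2 * n + 1) * (1 - PowerSeries.X) * h5
  -- The constant coefficient of `logSeries` is -(1/0), which is 0 by convention, as log 1 requires.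
  · have : PowerSeries.coeff 0 ((legR n m 1 : PowerSeries ℂ) * logSeries) = 0 := by
      simp [PowerSeries.coeff_mul, logSeries]
    rw [map_sub, map_add, Polynomial.coeff_coe, hs0, this]
    ring

end Log
end

/-! ### Analytic continuation through integrals along segments. -/

noncomputable section
open MeasureTheory

theorem isOpen_hypDomain : IsOpen hypDomain :=
  Complex.isOpen_slitPlane.preimage (by fun_prop : Continuous fun w : ℂ => 1 - w)

theorem mul_mem_hypDomain {w : ℂ} (hw : w ∈ hypDomain) {s : ℝ} (h0 : 0 ≤ s) (h1 : s ≤ 1) :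
    w * s ∈ hypDomain := by
  have h := Complex.starConvex_one_slitPlane hw (sub_nonneg.2 h1) h0 (by ring)
  have e : 1 - w * s = (1 - s) • (1 : ℂ) + s • (1 - w) := by
    simp only [Complex.real_smul]; push_cast; ring
  change 1 - w * s ∈ Complex.slitPlane
  rwa [e]

theorem zero_mem_hypDomain : (0 : ℂ) ∈ hypDomain := by simp [hypDomain]

theorem isPreconnected_hypDomain : IsPreconnected hypDomain := by
  have hstar : StarConvex ℝ (0 : ℂ) hypDomain := by
    intro w hw s t hs ht hst
    have := mul_mem_hypDomain hw ht (by linarith)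
    simpa [mul_comm] using this
  exact (hstar.isPathConnected zero_mem_hypDomain).isConnected.isPreconnected

theorem hasFPowerSeriesAt_of_hasSum {f : ℂ → ℂ} {c : ℕ → ℂ}
    (h : ∀ x ∈ Metric.ball (0 : ℂ) 1, HasSum (fun k => c k * x ^ k) (f x)) :
    HasFPowerSeriesAt f (FormalMultilinearSeries.ofScalars ℂ c) 0 := by
  rw [hasFPowerSeriesAt_iff]
  filter_upwards [Metric.ball_mem_nhds (0 : ℂ) one_pos] with x hx
  simpa [FormalMultilinearSeries.coeff_ofScalars, mul_comm] using h x hx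

/-- Tails of the Taylor series of a holomorphic function on the cut plane continue to the cut
plane. -/
theorem exists_tail {f : ℂ → ℂ} {c : ℕ → ℂ} (hf : DifferentiableOn ℂ f hypDomain)
    (h : ∀ x ∈ Metric.ball (0 : ℂ) 1, HasSum (fun k => c k * x ^ k) (f x)) (N : ℕ) :
    ∃ g : ℂ → ℂ, DifferentiableOn ℂ g hypDomain ∧
      ∀ x ∈ Metric.ball (0 : ℂ) 1, HasSum (fun k => c (k + N) * x ^ k) (g x) := by
  induction N with
  | zero => exact ⟨f, hf, h⟩
  | succ N ih =>
    obtain ⟨g, hg, hgs⟩ := ih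
    -- The difference quotient at 0 removes the constant term and shifts the Taylor coefficients by
    -- one.
    refine ⟨dslope g 0, (Complex.differentiableOn_dslope
      (isOpen_hypDomain.mem_nhds zero_mem_hypDomain)).2 hg, fun x hx => ?_⟩
    by_cases hx0 : x = 0
    · subst hx0
      have h1 := (hasFPowerSeriesAt_of_hasSum hgs).deriv
      rw [dslope_same, h1]
      have h2 := hasSum_single (f := fun k => c (k + (N + 1)) * (0 : ℂ) ^ k) 0 (by
        intro k hk; simp [hk])
      convert h2 using 1
      rw [FormalMultilinearSeries.ofScalars_apply_eq]
      simp [add_comm]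
    · have h0 : g 0 = c N := by
        have h2 := hasSum_single (f := fun k => c (k + N) * (0 : ℂ) ^ k) 0 (by
          intro k hk; simp [hk])
        simpa using (hgs 0 (by simp)).unique h2
      rw [dslope_of_ne _ hx0, slope_def_field, sub_zero]
      have h1 := (hasSum_nat_add_iff' 1).2 (hgs x hx)
      have h2 := h1.div_const x
      simp only [Finset.range_one, Finset.sum_singleton, zero_add, pow_zero, mul_one] at h2
      rw [h0]
      have e (k : ℕ) : c (k + (N + 1)) * x ^ k = c (k + 1 + N) * x ^ (k + 1) / x := by
        rw [show k + 1 + N = k + (N + 1) by ring, pow_succ]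
        field_simp
      rw [funext e]
      exact h2

/-- A weighted integral of a holomorphic function along segments starting at `0` is holomorphic. -/
theorem differentiableOn_integral_segment {W : ℝ → ℂ} (hW : IntervalIntegrable W volume 0 1)
    {σ : ℝ → ℝ} (hσ : Continuous σ) (hσ0 : ∀ t ∈ Set.Icc (0 : ℝ) 1, σ t ∈ Set.Icc (0 : ℝ) 1)
    {g : ℂ → ℂ} (hg : DifferentiableOn ℂ g hypDomain) :
    DifferentiableOn ℂ (fun w => ∫ t in (0 : ℝ)..1, W t * g (w * σ t)) hypDomain := by
  intro w₀ hw₀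
  refine DifferentiableAt.differentiableWithinAt ?_
  obtain ⟨δ, hδ, hball⟩ := Metric.nhds_basis_closedBall.mem_iff.1 (isOpen_hypDomain.mem_nhds hw₀)
  have hu : Set.uIoc (0 : ℝ) 1 = Set.Ioc 0 1 := Set.uIoc_of_le zero_le_one
  have hmem : ∀ w ∈ Metric.closedBall w₀ δ, ∀ t ∈ Set.Icc (0 : ℝ) 1, w * σ t ∈ hypDomain :=
    fun w hw t ht => mul_mem_hypDomain (hball hw) (hσ0 t ht).1 (hσ0 t ht).2
  have hg' : DifferentiableOn ℂ (deriv g) hypDomain := hg.deriv isOpen_hypDomain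
  obtain ⟨C, hC⟩ := ((isCompact_closedBall w₀ δ).prod isCompact_Icc).exists_bound_of_continuousOn
    (f := fun p : ℂ × ℝ => deriv g (p.1 * σ p.2)) (s := Metric.closedBall w₀ δ ×ˢ Set.Icc 0 1)
    (hg'.continuousOn.comp (by fun_prop) fun p hp => hmem p.1 hp.1 p.2 hp.2)
  have hcont : ∀ (k : ℂ → ℂ), DifferentiableOn ℂ k hypDomain → ∀ w ∈ Metric.closedBall w₀ δ,
      ContinuousOn (fun t : ℝ => k (w * σ t)) (Set.Icc 0 1) := fun k hk w hw =>
    hk.continuousOn.comp (by fun_prop) fun t ht => hmem w hw t ht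
  have hcont' : ∀ (k : ℂ → ℂ), DifferentiableOn ℂ k hypDomain → ∀ w ∈ Metric.closedBall w₀ δ,
      AEStronglyMeasurable (fun t : ℝ => k (w * σ t)) (volume.restrict (Set.uIoc 0 1)) := by
    intro k hk w hw
    rw [hu]
    exact ((hcont k hk w hw).mono Set.Ioc_subset_Icc_self).aestronglyMeasurable measurableSet_Ioc
  have hWm : AEStronglyMeasurable W (volume.restrict (Set.uIoc 0 1)) :=
    hW.def'.aestronglyMeasurable
  have hw₀' : w₀ ∈ Metric.closedBall w₀ δ := Metric.mem_closedBall_self hδ.le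
  refine (intervalIntegral.hasDerivAt_integral_of_dominated_loc_of_deriv_le
    (F' := fun w t => W t * (deriv g (w * σ t) * σ t)) (bound := fun t => ‖W t‖ * C)
    (Metric.closedBall_mem_nhds w₀ hδ) ?_ ?_ ?_ ?_ ?_ ?_).2.differentiableAt
  · filter_upwards [Metric.closedBall_mem_nhds w₀ hδ] with w hw
    exact hWm.mul (hcont' g hg w hw)
  · refine hW.mul_continuousOn ?_
    rw [Set.uIcc_of_le zero_le_one]
    exact hcont g hg w₀ hw₀'
  · exact hWm.mul ((hcont' _ hg' w₀ hw₀').mul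
      (by fun_prop : Continuous fun t : ℝ => (σ t : ℂ)).aestronglyMeasurable)
  · filter_upwards with t ht w hw
    rw [hu] at ht
    have ht' := Set.Ioc_subset_Icc_self ht
    have h1 : ‖(σ t : ℂ)‖ ≤ 1 := by
      rw [Complex.norm_real, Real.norm_of_nonneg (hσ0 t ht').1]; exact (hσ0 t ht').2
    have h2 := hC (w, t) ⟨hw, ht'⟩
    rw [norm_mul, norm_mul]
    refine mul_le_mul_of_nonneg_left ?_ (norm_nonneg _)
    exact (mul_le_mul h2 h1 (norm_nonneg _) ((norm_nonneg _).trans h2)).trans (mul_one C).le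
  · exact hW.norm.mul_const C
  · filter_upwards with t ht w hw
    rw [hu] at ht
    have hd := (hg.differentiableAt (isOpen_hypDomain.mem_nhds
      (hmem w hw t (Set.Ioc_subset_Icc_self ht)))).hasDerivAt
    have h1 : HasDerivAt (fun w : ℂ => w * σ t) (σ t : ℂ) w := by
      simpa using (hasDerivAt_id w).mul_const (σ t : ℂ)
    exact (hd.comp w h1).const_mul (W t)

theorem hasSum_integral_segment {W : ℝ → ℂ} (hW : IntervalIntegrable W volume 0 1)
    {σ : ℝ → ℝ} (hσ : Continuous σ) (hσ0 : ∀ t ∈ Set.Icc (0 : ℝ) 1, σ t ∈ Set.Icc (0 : ℝ) 1)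
    {g : ℂ → ℂ} {c : ℕ → ℂ}
    (h : ∀ x ∈ Metric.ball (0 : ℂ) 1, HasSum (fun k => c k * x ^ k) (g x))
    {w : ℂ} (hw : w ∈ Metric.ball (0 : ℂ) 1) :
    HasSum (fun k => ∫ t in (0 : ℝ)..1, W t * (c k * (w * σ t) ^ k))
      (∫ t in (0 : ℝ)..1, W t * g (w * σ t)) := by
  have hu : Set.uIoc (0 : ℝ) 1 = Set.Ioc 0 1 := Set.uIoc_of_le zero_le_one
  have hs : Summable fun k => ‖c k * w ^ k‖ := (h w hw).summable.norm
  refine intervalIntegral.hasSum_integral_of_dominated_convergence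
    (fun k t => ‖W t‖ * ‖c k * w ^ k‖) ?_ ?_ ?_ ?_ ?_
  · intro k
    exact hW.def'.aestronglyMeasurable.mul
      (by fun_prop : Continuous fun t : ℝ => c k * (w * σ t) ^ k).aestronglyMeasurable
  · intro k
    filter_upwards with t ht
    rw [hu] at ht
    have ht' := hσ0 t (Set.Ioc_subset_Icc_self ht)
    rw [norm_mul, mul_pow, ← mul_assoc, norm_mul (_ * _)]
    refine mul_le_mul_of_nonneg_left (mul_le_of_le_one_right (norm_nonneg _) ?_) (norm_nonneg _)
    rw [norm_pow, Complex.norm_real, Real.norm_of_nonneg ht'.1]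
    exact pow_le_one₀ ht'.1 ht'.2
  · filter_upwards with t _
    exact hs.mul_left _
  · simp only [tsum_mul_left]
    exact hW.norm.mul_const _
  · filter_upwards with t ht
    rw [hu] at ht
    have ht' := hσ0 t (Set.Ioc_subset_Icc_self ht)
    refine (h _ ?_).mul_left _
    rw [mem_ball_zero_iff] at hw ⊢
    rw [norm_mul, Complex.norm_real, Real.norm_of_nonneg ht'.1]
    exact (mul_le_of_le_one_right (norm_nonneg _) ht'.2).trans_lt hw

/-- The reciprocals `1 / (Γ(1 - m + k) k!)` at natural `m`. -/
def regCoeff (m k : ℕ) : ℂ := if k < m then 0 else 1 / ((k - m).factorial * k.factorial)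

/-- For k < m the argument is a pole of Γ, where the conventional value 0 has inverse 0, the true
value of 1/Γ. -/
theorem regCoeff_eq (m k : ℕ) :
    (Complex.Gamma (1 - m + k))⁻¹ / (k.factorial : ℂ) = regCoeff m k := by
  rw [regCoeff]
  split_ifs with h
  · have : (1 - m + k : ℂ) = -((m - 1 - k : ℕ) : ℂ) := by
      rw [Nat.sub_sub, Nat.cast_sub (by omega)]; push_cast; ring
    rw [this, Complex.Gamma_neg_nat_eq_zero]; simp
  · have : (1 - m + k : ℂ) = ((k - m : ℕ) : ℂ) + 1 := by
      rw [Nat.cast_sub (by omega)]; ring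
    rw [this, Complex.Gamma_nat_eq_factorial]
    field_simp

theorem ascPochhammer_one_half (k : ℕ) : (ascPochhammer ℂ k).eval (1 / 2) =
    (2 * k).factorial / (4 ^ k * k.factorial) := by
  induction k with
  | zero => simp
  | succ k ih =>
    rw [ascPochhammer_succ_eval, ih, show 2 * (k + 1) = 2 * k + 1 + 1 by ring,
      Nat.factorial_succ (2 * k + 1), Nat.factorial_succ (2 * k), Nat.factorial_succ k]
    have e1 : (k.factorial : ℂ) ≠ 0 := by exact_mod_cast Nat.factorial_ne_zero _
    have e2 : (k + 1 : ℂ) ≠ 0 := by exact_mod_cast Nat.succ_ne_zero k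
    push_cast
    field_simp
    ring

theorem ascPochhammer_add_eval (s : ℂ) (m j : ℕ) : (ascPochhammer ℂ (j + m)).eval s =
    (ascPochhammer ℂ m).eval s * (ascPochhammer ℂ j).eval (s + m) := by
  induction j with
  | zero => simp
  | succ j ih =>
    rw [show j + 1 + m = j + m + 1 by ring, ascPochhammer_succ_eval, ih, ascPochhammer_succ_eval]
    push_cast; ring

theorem choose_eq_ascPochhammer (a : ℂ) (j : ℕ) :
    Ring.choose (a + j - 1) j = (ascPochhammer ℂ j).eval a / j.factorial := by
  have h := Ring.factorial_nsmul_multichoose_eq_ascPochhammer a j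
  rw [Polynomial.ascPochhammer_smeval_eq_eval, nsmul_eq_mul] at h
  have e1 : (j.factorial : ℂ) ≠ 0 := by exact_mod_cast Nat.factorial_ne_zero _
  rw [Ring.choose, eq_div_iff e1, mul_comm, ← h]
  congr 2; ring

/-- The kernel `∑ (2k)! / ((k - m)! k! 4 ^ k) x ^ k` continues to the cut plane. -/
theorem exists_kernel (m : ℕ) : ∃ f : ℂ → ℂ, DifferentiableOn ℂ f hypDomain ∧
    ∀ x ∈ Metric.ball (0 : ℂ) 1,
      HasSum (fun k => regCoeff m k * (2 * k).factorial / 4 ^ k * x ^ k) (f x) := by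
  -- Since (2k)!/(4^k k!) = (1/2)_k and (1/2)_(j+m) = (1/2)_m (1/2 + m)_j, the sum over k = j + m is
  -- a binomial series with exponent -(1/2 + m).
  refine ⟨fun x => x ^ m * ((ascPochhammer ℂ m).eval (1 / 2) * (1 / (1 - x) ^ (1 / 2 + m : ℂ))),
    ?_, ?_⟩
  · intro x hx
    have hx' : 1 - x ∈ Complex.slitPlane := hx
    have h0 : (1 - x) ^ (1 / 2 + m : ℂ) ≠ 0 := by
      rw [Ne, Complex.cpow_eq_zero_iff]
      exact fun h => Complex.slitPlane_ne_zero hx' h.1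
    refine DifferentiableAt.differentiableWithinAt ?_
    have h1 : DifferentiableAt ℂ (fun x : ℂ => (1 - x) ^ (1 / 2 + m : ℂ)) x :=
      DifferentiableAt.cpow (by fun_prop) (by fun_prop) hx'
    exact (by fun_prop : DifferentiableAt ℂ (fun x : ℂ => x ^ m) x).mul
      (((differentiableAt_const _).div h1 h0).const_mul _)
  · intro x hx
    have h := (Complex.one_div_one_sub_cpow_hasFPowerSeriesOnBall_zero (1 / 2 + m)).hasSum
      (y := x) (by rw [← ENNReal.ofReal_one, Metric.eball_ofReal]; exact hx)
    simp only [FormalMultilinearSeries.ofScalars_apply_eq, zero_add, smul_eq_mul] at h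
    have h' := h.mul_left (x ^ m * (ascPochhammer ℂ m).eval (1 / 2))
    rw [← hasSum_nat_add_iff' m, Finset.sum_eq_zero, sub_zero]
    · simp only [← mul_assoc (x ^ m)]
      have e (j : ℕ) : regCoeff m (j + m) * (2 * (j + m)).factorial / 4 ^ (j + m) * x ^ (j + m) =
          x ^ m * (ascPochhammer ℂ m).eval (1 / 2) *
            (Ring.choose (1 / 2 + m + j - 1 : ℂ) j * x ^ j) := by
        have h2 := ascPochhammer_add_eval (1 / 2) m j
        rw [ascPochhammer_one_half] at h2
        have e1 : (j.factorial : ℂ) ≠ 0 := by exact_mod_cast Nat.factorial_ne_zero _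
        rw [choose_eq_ascPochhammer, regCoeff, if_neg (by omega), Nat.add_sub_cancel, pow_add x]
        calc _ = ((2 * (j + m)).factorial / (4 ^ (j + m) * (j + m).factorial) : ℂ) / j.factorial
              * (x ^ j * x ^ m) := by
              have e2 : ((j + m).factorial : ℂ) ≠ 0 := by exact_mod_cast Nat.factorial_ne_zero _
              field_simp
          _ = _ := by rw [h2]; ring
      rw [funext e]
      exact h'
    · intro k hk
      simp [regCoeff, Finset.mem_range.1 hk]

/-- Only k > n is kept, so that k - ν has positive real part near ν = n and the beta integrals
converge. -/
theorem exists_kernel_tail (n m : ℕ) : ∃ f : ℂ → ℂ, DifferentiableOn ℂ f hypDomain ∧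
    ∀ x ∈ Metric.ball (0 : ℂ) 1, HasSum (fun k => regCoeff m (k + (n + 1)) *
      (2 * (k + (n + 1))).factorial / 4 ^ (k + (n + 1)) * x ^ k) (f x) := by
  obtain ⟨f, hf, hs⟩ := exists_kernel m
  exact exists_tail (c := fun k => regCoeff m k * (2 * k).factorial / 4 ^ k) hf hs (n + 1)

end

/-! ### Differentiability in the degree at ν = n. -/

noncomputable section
open MeasureTheory

/-- Continuation of `∑ (2k)! / ((k - m)! k! 4 ^ k) x ^ (k - n - 1)`, the sum over `k > n`. -/
def tailKernel (n m : ℕ) : ℂ → ℂ := (exists_kernel_tail n m).choose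

theorem differentiableOn_tailKernel (n m : ℕ) : DifferentiableOn ℂ (tailKernel n m) hypDomain :=
  (exists_kernel_tail n m).choose_spec.1

theorem hasSum_tailKernel (n m : ℕ) : ∀ x ∈ Metric.ball (0 : ℂ) 1,
    HasSum (fun k => regCoeff m (k + (n + 1)) *
      (2 * (k + (n + 1))).factorial / 4 ^ (k + (n + 1)) * x ^ k) (tailKernel n m x) :=
  (exists_kernel_tail n m).choose_spec.2

/-- Integral representation of `∑ Γ(k - ν) Γ(k + ν + 1) / ((k - m)! k!) w ^ k`, the sum over
`k > n`, for `ν` close to `n`. -/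
def tailIntegral (n m : ℕ) (ν w : ℂ) : ℂ :=
  4 ^ (n + 1) * w ^ (n + 1) * ∫ t in (0 : ℝ)..1,
    (t : ℂ) ^ (n + 1 - ν - 1 : ℂ) * (1 - (t : ℂ)) ^ (n + 2 + ν - 1 : ℂ) *
      tailKernel n m (w * (4 * t * (1 - t) : ℝ))

theorem re_bounds {n : ℕ} {ν : ℂ} (hν : ‖ν - n‖ < 1 / 2) :
    ν.re < n + 1 / 2 ∧ (n : ℝ) - 1 / 2 < ν.re := by
  have h := (Complex.abs_re_le_norm (ν - n)).trans_lt hν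
  rw [abs_lt, Complex.sub_re, Complex.natCast_re] at h
  constructor <;> linarith [h.1, h.2]

theorem bump_mem_Icc : ∀ t ∈ Set.Icc (0 : ℝ) 1, 4 * t * (1 - t) ∈ Set.Icc (0 : ℝ) 1 := by
  intro t ht
  constructor
  · have := mul_nonneg ht.1 (sub_nonneg.2 ht.2); linarith
  · nlinarith [sq_nonneg (2 * t - 1)]

theorem intervalIntegrable_weight {n : ℕ} {ν : ℂ} (hν : ‖ν - n‖ < 1 / 2) :
    IntervalIntegrable (fun t : ℝ => (t : ℂ) ^ (n + 1 - ν - 1 : ℂ) *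
      (1 - (t : ℂ)) ^ (n + 2 + ν - 1 : ℂ)) volume 0 1 := by
  obtain ⟨h1, h2⟩ := re_bounds hν
  have h3 : (0 : ℝ) ≤ n := n.cast_nonneg
  refine Complex.betaIntegral_convergent ?_ ?_
  · simp; linarith
  · simp; linarith

theorem differentiableOn_tailIntegral {n : ℕ} (m : ℕ) {ν : ℂ} (hν : ‖ν - n‖ < 1 / 2) :
    DifferentiableOn ℂ (tailIntegral n m ν) hypDomain := by
  have h := differentiableOn_integral_segment (intervalIntegrable_weight hν)
    (σ := fun t => 4 * t * (1 - t)) (by fun_prop) bump_mem_Icc (differentiableOn_tailKernel n m)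
  exact (by fun_prop : DifferentiableOn ℂ (fun w : ℂ => 4 ^ (n + 1) * w ^ (n + 1)) hypDomain).mul h

/-- The k-th power of t(1 - t) raises both beta exponents by k. The factor 4 scales t(1 - t) into
[0, 1], which keeps the argument on the segment from 0 to w; the kernel's 4^(-k) offsets it. -/
theorem integral_weight_mul_pow {n : ℕ} {ν : ℂ} (hν : ‖ν - n‖ < 1 / 2) (c w : ℂ) (k : ℕ) :
    ∫ t in (0 : ℝ)..1, (t : ℂ) ^ (n + 1 - ν - 1 : ℂ) * (1 - (t : ℂ)) ^ (n + 2 + ν - 1 : ℂ) *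
      (c * (w * (4 * t * (1 - t) : ℝ)) ^ k) =
    c * w ^ k * 4 ^ k * Complex.betaIntegral (n + 1 - ν + k) (n + 2 + ν + k) := by
  obtain ⟨h1, h2⟩ := re_bounds hν
  have h3 : (0 : ℝ) ≤ n := n.cast_nonneg
  rw [Complex.betaIntegral, ← intervalIntegral.integral_const_mul]
  refine intervalIntegral.integral_congr_ae (Filter.Eventually.of_forall fun t ht => ?_)
  rw [Set.uIoc_of_le zero_le_one] at ht
  have ht0 : (t : ℂ) ≠ 0 := by exact_mod_cast ht.1.ne'
  push_cast
  -- At t = 1 the powers cannot be split with `cpow_add`, but both exponents are nonzero and both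
  -- sides vanish.
  by_cases ht1 : (1 - (t : ℂ)) = 0
  · have e1 : (n + 2 + ν - 1 : ℂ) ≠ 0 := fun h => by
      have := congrArg Complex.re h; simp at this; linarith
    have e2 : (n + 2 + ν + k - 1 : ℂ) ≠ 0 := fun h => by
      have := congrArg Complex.re h
      have h4 : (0 : ℝ) ≤ k := k.cast_nonneg
      simp at this; linarith
    rw [ht1, Complex.zero_cpow e1, Complex.zero_cpow e2]; simp
  · rw [show (n + 1 - ν + k - 1 : ℂ) = (n + 1 - ν - 1) + k by ring,
      show (n + 2 + ν + k - 1 : ℂ) = (n + 2 + ν - 1) + k by ring, Complex.cpow_add _ _ ht0,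
      Complex.cpow_add _ _ ht1, Complex.cpow_natCast, Complex.cpow_natCast]
    simp only [mul_pow]
    ring

theorem hasSum_tailIntegral {n : ℕ} (m : ℕ) {ν : ℂ} (hν : ‖ν - n‖ < 1 / 2) {w : ℂ}
    (hw : w ∈ Metric.ball (0 : ℂ) 1) :
    HasSum (fun k => regCoeff m (k + (n + 1)) * (Complex.Gamma ((k + (n + 1) : ℕ) - ν) *
      Complex.Gamma ((k + (n + 1) : ℕ) + ν + 1)) * w ^ (k + (n + 1))) (tailIntegral n m ν w) := by
  obtain ⟨h1, h2⟩ := re_bounds hν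
  have h3 : (0 : ℝ) ≤ n := n.cast_nonneg
  have h := (hasSum_integral_segment (intervalIntegrable_weight hν)
    (σ := fun t => 4 * t * (1 - t)) (by fun_prop) bump_mem_Icc
    (hasSum_tailKernel n m) hw).mul_left (4 ^ (n + 1) * w ^ (n + 1))
  have e (k : ℕ) : regCoeff m (k + (n + 1)) * (Complex.Gamma ((k + (n + 1) : ℕ) - ν) *
      Complex.Gamma ((k + (n + 1) : ℕ) + ν + 1)) * w ^ (k + (n + 1)) =
      4 ^ (n + 1) * w ^ (n + 1) * ∫ t in (0 : ℝ)..1, (t : ℂ) ^ (n + 1 - ν - 1 : ℂ) *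
        (1 - (t : ℂ)) ^ (n + 2 + ν - 1 : ℂ) * (regCoeff m (k + (n + 1)) *
        (2 * (k + (n + 1))).factorial / 4 ^ (k + (n + 1)) * (w * (4 * t * (1 - t) : ℝ)) ^ k) := by
    have h4 : (0 : ℝ) ≤ k := k.cast_nonneg
    rw [integral_weight_mul_pow hν]
    have hB := Complex.Gamma_mul_Gamma_eq_betaIntegral (s := n + 1 - ν + k) (t := n + 2 + ν + k)
      (by simp; linarith) (by simp; linarith)
    have hG : Complex.Gamma ((n + 1 - ν + k) + (n + 2 + ν + k)) = (2 * (k + (n + 1))).factorial := by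
      rw [← Complex.Gamma_nat_eq_factorial]; congr 1; push_cast; ring
    rw [hG] at hB
    rw [show ((k + (n + 1) : ℕ) - ν : ℂ) = n + 1 - ν + k by push_cast; ring,
      show ((k + (n + 1) : ℕ) + ν + 1 : ℂ) = n + 2 + ν + k by push_cast; ring, hB, pow_add w,
      pow_add 4 k]
    have e4 : (4 : ℂ) ^ k ≠ 0 := pow_ne_zero _ (by norm_num)
    have e5 : (4 : ℂ) ^ (n + 1) ≠ 0 := pow_ne_zero _ (by norm_num)
    field_simp
  rw [funext e]
  exact h

theorem eventually_norm_sub_natCast_lt (n : ℕ) : ∀ᶠ ν : ℂ in 𝓝 (n : ℂ), ‖ν - n‖ < 1 / 2 := by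
  filter_upwards [Metric.ball_mem_nhds (n : ℂ) (by norm_num : (0 : ℝ) < 1 / 2)] with ν hν
  simpa [dist_eq_norm] using hν

/-- Differentiability in ν is not needed: the integral is multiplied by a sine vanishing at n. -/
theorem continuousAt_tailIntegral (n m : ℕ) {w : ℂ} (hw : w ∈ hypDomain) :
    ContinuousAt (fun ν => tailIntegral n m ν w) n := by
  refine continuousAt_const.mul ?_
  have hmem : ∀ t ∈ Set.Icc (0 : ℝ) 1, w * (4 * t * (1 - t) : ℝ) ∈ hypDomain := fun t ht =>
    mul_mem_hypDomain hw (bump_mem_Icc t ht).1 (bump_mem_Icc t ht).2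
  have hc : ContinuousOn (fun t : ℝ => tailKernel n m (w * (4 * t * (1 - t) : ℝ)))
      (Set.Icc 0 1) :=
    (differentiableOn_tailKernel n m).continuousOn.comp (by fun_prop) hmem
  obtain ⟨C, hC⟩ := isCompact_Icc.exists_bound_of_continuousOn hc
  have hu : Set.uIoc (0 : ℝ) 1 = Set.Ioc 0 1 := Set.uIoc_of_le zero_le_one
  -- For ‖ν - n‖ < 1/2 the exponent of t has real part above -1/2, the power of 1 - t has modulus at
  -- most 1, and C bounds the kernel.
  refine intervalIntegral.continuousAt_of_dominated_interval
    (bound := fun t => t ^ (-(1 / 2) : ℝ) * C) ?_ ?_ ?_ ?_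
  · filter_upwards [eventually_norm_sub_natCast_lt n] with ν hν
    refine (intervalIntegrable_weight hν).def'.aestronglyMeasurable.mul ?_
    rw [hu]
    exact (hc.mono Set.Ioc_subset_Icc_self).aestronglyMeasurable measurableSet_Ioc
  · filter_upwards [eventually_norm_sub_natCast_lt n] with ν hν
    obtain ⟨h1, h2⟩ := re_bounds hν
    have h3 : (0 : ℝ) ≤ n := n.cast_nonneg
    filter_upwards with t ht
    rw [hu] at ht
    have hC' := hC t (Set.Ioc_subset_Icc_self ht)
    rw [norm_mul, norm_mul, Complex.norm_cpow_eq_rpow_re_of_pos ht.1,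
      show (1 - (t : ℂ)) = ((1 - t : ℝ) : ℂ) by push_cast; rfl,
      Complex.norm_cpow_eq_rpow_re_of_nonneg (sub_nonneg.2 ht.2) (by simp; linarith)]
    refine mul_le_mul ?_ hC' (norm_nonneg _) (Real.rpow_nonneg ht.1.le _)
    refine (mul_le_of_le_one_right (Real.rpow_nonneg ht.1.le _)
      (Real.rpow_le_one (sub_nonneg.2 ht.2) (by linarith [ht.1]) (by simp; linarith))).trans ?_
    exact Real.rpow_le_rpow_of_exponent_ge ht.1 ht.2 (by simp; linarith)
  · exact (intervalIntegral.intervalIntegrable_rpow' (by norm_num)).mul_const C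
  · filter_upwards with t ht
    rw [hu] at ht
    have ht0 : (t : ℂ) ≠ 0 := by exact_mod_cast ht.1.ne'
    refine (ContinuousAt.mul ?_ ?_).mul continuousAt_const
    · exact ContinuousAt.const_cpow (by fun_prop) (Or.inl ht0)
    -- The base is 0 at t = 1, so continuity comes from the exponent 2n + 1 being nonzero.
    · refine ContinuousAt.const_cpow (by fun_prop) (Or.inr ?_)
      rw [show (n + 2 + n - 1 : ℂ) = ((2 * n + 1 : ℕ) : ℂ) by push_cast; ring]
      exact_mod_cast Nat.succ_ne_zero (2 * n)

theorem ascPochhammer_mul_Gamma {s : ℂ} (hs : ∀ j : ℕ, s ≠ -j) (k : ℕ) :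
    (ascPochhammer ℂ k).eval s * Complex.Gamma s = Complex.Gamma (k + s) := by
  induction k with
  | zero => simp
  | succ k ih =>
    have h0 : (k + s : ℂ) ≠ 0 := fun h => hs k (by linear_combination h)
    rw [ascPochhammer_succ_eval, Nat.cast_succ, show (k + 1 + s : ℂ) = k + s + 1 by ring,
      Complex.Gamma_add_one _ h0, ← ih]
    ring

/-- Reflection formula for the numerators of the Legendre series. -/
theorem ascPochhammer_mul_ascPochhammer {n k : ℕ} (hk : n < k) {ν : ℂ} (hν : ‖ν - n‖ < 1 / 2) :
    (ascPochhammer ℂ k).eval (-ν) * (ascPochhammer ℂ k).eval (ν + 1) =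
      -(Complex.sin (Real.pi * ν) / Real.pi) *
        (Complex.Gamma (k - ν) * Complex.Gamma (k + ν + 1)) := by
  obtain ⟨h1, h2⟩ := re_bounds hν
  -- At ν = n both sides vanish; elsewhere in the disc neither Γ(-ν) nor Γ(ν + 1) has a pole.
  by_cases h : ν = n
  · subst h
    rw [ascPochhammer_eval_neg_coe_nat_of_lt hk, mul_comm (Real.pi : ℂ), Complex.sin_nat_mul_pi]
    simp
  · have e1 : ∀ j : ℕ, -ν ≠ -j := by
      intro j hj
      obtain rfl : ν = j := neg_injective hj
      rw [Complex.natCast_re] at h1 h2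
      have h3 : (j : ℝ) < n + 1 := by linarith
      have h4 : (n : ℝ) < j + 1 := by linarith
      norm_cast at h3 h4
      exact h (by rw [show j = n by omega])
    have e2 : ∀ j : ℕ, ν + 1 ≠ -j := by
      intro j hj
      have := congrArg Complex.re hj
      have h3 : (0 : ℝ) ≤ n := n.cast_nonneg
      have h4 : (0 : ℝ) ≤ j := j.cast_nonneg
      simp at this
      linarith
    have g1 := ascPochhammer_mul_Gamma e1 k
    have g2 := ascPochhammer_mul_Gamma e2 k
    have g3 := Complex.Gamma_mul_Gamma_one_sub (-ν)
    rw [sub_neg_eq_add, add_comm 1 ν, mul_neg, Complex.sin_neg] at g3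
    have n1 := Complex.Gamma_ne_zero e1
    have n2 := Complex.Gamma_ne_zero e2
    have hpi : (Real.pi : ℂ) ≠ 0 := by exact_mod_cast Real.pi_ne_zero
    have hs : Complex.sin (Real.pi * ν) ≠ 0 := by
      intro hs
      rw [hs] at g3
      simp at g3
      tauto
    rw [sub_eq_add_neg, add_assoc (k : ℂ), ← g1, ← g2]
    have g4 : Complex.sin (Real.pi * ν) * (Complex.Gamma (-ν) * Complex.Gamma (ν + 1)) =
      -Real.pi := by rw [g3]; field_simp
    generalize Complex.sin (Real.pi * ν) = S at *
    field_simp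
    linear_combination (ascPochhammer ℂ k).eval (-ν) * (ascPochhammer ℂ k).eval (ν + 1) * g4

/-- Coefficients of the regularized Gauss series of the Legendre functions of integer order. -/
def legCoeff (m k : ℕ) (ν : ℂ) : ℂ :=
  (ascPochhammer ℂ k).eval (-ν) * (ascPochhammer ℂ k).eval (ν + 1) * regCoeff m k

/-- The continuation of the regularized Gauss series for degrees close to `n`. -/
def legHyp (n m : ℕ) (ν w : ℂ) : ℂ :=
  ∑ k ∈ Finset.range (n + 1), legCoeff m k ν * w ^ k
    - Complex.sin (Real.pi * ν) / Real.pi * tailIntegral n m ν w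

theorem isRegHyp_legHyp {n : ℕ} (m : ℕ) {ν : ℂ} (hν : ‖ν - n‖ < 1 / 2) :
    IsRegHyp (-ν) (ν + 1) (1 - m) (legHyp n m ν) := by
  constructor
  · exact DifferentiableOn.sub (by fun_prop)
      ((differentiableOn_tailIntegral m hν).const_mul _)
  · intro w hw
    have e (k : ℕ) : (ascPochhammer ℂ k).eval (-ν) * (ascPochhammer ℂ k).eval (ν + 1) *
        (Complex.Gamma (1 - m + k))⁻¹ / (k.factorial : ℂ) * w ^ k = legCoeff m k ν * w ^ k := by
      rw [legCoeff, ← regCoeff_eq]; ring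
    rw [regHypSeries, funext e]
    refine (HasSum.tsum_eq ?_).symm
    rw [← hasSum_nat_add_iff' (n + 1)]
    have h := (hasSum_tailIntegral m hν hw).mul_left (-(Complex.sin (Real.pi * ν) / Real.pi))
    have e2 (k : ℕ) : legCoeff m (k + (n + 1)) ν * w ^ (k + (n + 1)) =
        -(Complex.sin (Real.pi * ν) / Real.pi) * (regCoeff m (k + (n + 1)) *
          (Complex.Gamma ((k + (n + 1) : ℕ) - ν) *
          Complex.Gamma ((k + (n + 1) : ℕ) + ν + 1)) * w ^ (k + (n + 1))) := by
      rw [legCoeff, ascPochhammer_mul_ascPochhammer (by omega) hν]; ring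
    rw [funext e2, legHyp, sub_sub_cancel_left, ← neg_mul]
    exact h

theorem regHyp_eq_of_isRegHyp {a b c : ℂ} {f : ℂ → ℂ} (hf : IsRegHyp a b c f) {w : ℂ}
    (hw : w ∈ hypDomain) : regHyp a b c w = f w := by
  have h : ∃ f, IsRegHyp a b c f := ⟨f, hf⟩
  rw [regHyp, dif_pos h]
  exact h.choose_spec.eqOn hf hw

theorem differentiable_legCoeff (m k : ℕ) : Differentiable ℂ (legCoeff m k) := by
  have h1 : Differentiable ℂ fun ν : ℂ => (ascPochhammer ℂ k).eval (-ν) :=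
    (ascPochhammer ℂ k).differentiable.comp differentiable_neg
  have h2 : Differentiable ℂ fun ν : ℂ => (ascPochhammer ℂ k).eval (ν + 1) :=
    (ascPochhammer ℂ k).differentiable.comp (by fun_prop)
  exact (h1.mul h2).mul_const _

/-- Where f vanishes, the slope of the product is the slope of f times g, so mere continuity of g
suffices. -/
theorem HasDerivAt.mul_of_eq_zero {f g : ℂ → ℂ} {f' x : ℂ} (hf : HasDerivAt f f' x)
    (h0 : f x = 0) (hg : ContinuousAt g x) : HasDerivAt (fun y => f y * g y) (f' * g x) x := by
  rw [hasDerivAt_iff_tendsto_slope] at hf ⊢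
  refine (hf.mul (hg.tendsto.mono_left nhdsWithin_le_nhds)).congr fun y => ?_
  rw [slope_def_field, slope_def_field, h0]
  ring

theorem complex_cos_nat_mul_pi (n : ℕ) : Complex.cos (n * Real.pi) = (-1) ^ n := by
  exact_mod_cast congrArg ((↑) : ℝ → ℂ) (Real.cos_nat_mul_pi n)

theorem hasDerivAt_sin_pi_div (n : ℕ) :
    HasDerivAt (fun ν : ℂ => Complex.sin (Real.pi * ν) / Real.pi) ((-1) ^ n) n := by
  have hpi : (Real.pi : ℂ) ≠ 0 := by exact_mod_cast Real.pi_ne_zero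
  have h := (((hasDerivAt_id (n : ℂ)).const_mul (Real.pi : ℂ)).csin).div_const (Real.pi : ℂ)
  refine h.congr_deriv ?_
  rw [id_eq, mul_comm (Real.pi : ℂ), complex_cos_nat_mul_pi]
  field_simp

/-- The derivative in the degree, at `n`, of the hypergeometric factor of `P_ν^m`. -/
def legHypDeriv (n m : ℕ) (w : ℂ) : ℂ :=
  ∑ k ∈ Finset.range (n + 1), deriv (legCoeff m k) n * w ^ k - (-1) ^ n * tailIntegral n m n w

theorem sin_pi_div_eq_zero (n : ℕ) : Complex.sin (Real.pi * (n : ℂ)) / Real.pi = 0 := by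
  rw [mul_comm (Real.pi : ℂ), Complex.sin_nat_mul_pi, zero_div]

theorem hasDerivAt_regHyp (n m : ℕ) {w : ℂ} (hw : w ∈ hypDomain) :
    HasDerivAt (fun ν => regHyp (-ν) (ν + 1) (1 - m) w) (legHypDeriv n m w) n := by
  have h1 : HasDerivAt (fun ν => legHyp n m ν w) (legHypDeriv n m w) n := by
    refine HasDerivAt.sub (HasDerivAt.fun_sum fun k _ =>
      ((differentiable_legCoeff m k) n).hasDerivAt.mul_const _) ?_
    exact (hasDerivAt_sin_pi_div n).mul_of_eq_zero (sin_pi_div_eq_zero n)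
      (continuousAt_tailIntegral n m hw)
  refine h1.congr_of_eventuallyEq ?_
  filter_upwards [eventually_norm_sub_natCast_lt n] with ν hν
  exact regHyp_eq_of_isRegHyp (isRegHyp_legHyp m hν) hw

theorem regHyp_nat (n m : ℕ) {w : ℂ} (hw : w ∈ hypDomain) :
    regHyp (-n) (n + 1) (1 - m) w = ∑ k ∈ Finset.range (n + 1), legCoeff m k n * w ^ k := by
  rw [regHyp_eq_of_isRegHyp (isRegHyp_legHyp (n := n) (ν := n) m (by norm_num)) hw, legHyp,
    sin_pi_div_eq_zero, zero_mul, sub_zero]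

theorem differentiableOn_legHypDeriv (n m : ℕ) :
    DifferentiableOn ℂ (legHypDeriv n m) hypDomain :=
  DifferentiableOn.sub (by fun_prop)
    ((differentiableOn_tailIntegral (n := n) (ν := n) m (by norm_num)).const_mul _)

/-- Identifies the Taylor coefficients of `legHypDeriv` beyond n, so that it satisfies a recursion
uniform in k. -/
theorem deriv_legCoeff_of_lt {n k : ℕ} (m : ℕ) (h : n < k) : deriv (legCoeff m k) n =
    -(-1) ^ n * (regCoeff m k * (Complex.Gamma (k - n) * Complex.Gamma (k + n + 1))) := by
  have hc : ContinuousAt (fun ν : ℂ => regCoeff m k *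
      (Complex.Gamma (k - ν) * Complex.Gamma (k + ν + 1))) n := by
    have g1 : DifferentiableAt ℂ Complex.Gamma (k - n : ℂ) := by
      refine Complex.differentiableAt_Gamma _ fun j hj => ?_
      have : (k + j : ℂ) = n := by linear_combination hj
      norm_cast at this
      omega
    have g2 : DifferentiableAt ℂ Complex.Gamma (k + n + 1 : ℂ) := by
      refine Complex.differentiableAt_Gamma _ fun j hj => ?_
      have : (k + n + j + 1 : ℂ) = 0 := by linear_combination hj
      exact absurd this (by exact_mod_cast Nat.succ_ne_zero (k + n + j))
    refine continuousAt_const.mul (ContinuousAt.mul ?_ ?_)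
    · exact ContinuousAt.comp (f := fun ν : ℂ => (k : ℂ) - ν) g1.continuousAt (by fun_prop)
    · exact ContinuousAt.comp (f := fun ν : ℂ => (k : ℂ) + ν + 1) g2.continuousAt (by fun_prop)
  have h1 := (hasDerivAt_sin_pi_div n).neg.mul_of_eq_zero
    (by rw [Pi.neg_apply, sin_pi_div_eq_zero, neg_zero]) hc
  refine (h1.congr_of_eventuallyEq ?_).deriv
  filter_upwards [eventually_norm_sub_natCast_lt n] with ν hν
  rw [legCoeff, ascPochhammer_mul_ascPochhammer h hν, Pi.neg_apply]
  ring

theorem hasSum_legHypDeriv (n m : ℕ) {w : ℂ} (hw : w ∈ Metric.ball (0 : ℂ) 1) :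
    HasSum (fun k => deriv (legCoeff m k) n * w ^ k) (legHypDeriv n m w) := by
  rw [← hasSum_nat_add_iff' (n + 1)]
  have h := (hasSum_tailIntegral m (ν := (n : ℂ)) (n := n) (by norm_num) hw).mul_left (-(-1) ^ n)
  have e (k : ℕ) : deriv (legCoeff m (k + (n + 1))) n * w ^ (k + (n + 1)) =
      -(-1) ^ n * (regCoeff m (k + (n + 1)) * (Complex.Gamma ((k + (n + 1) : ℕ) - n) *
        Complex.Gamma ((k + (n + 1) : ℕ) + n + 1)) * w ^ (k + (n + 1))) := by
    rw [deriv_legCoeff_of_lt m (by omega)]; ring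
  rw [funext e, legHypDeriv, sub_sub_cancel_left, ← neg_mul]
  exact h

/-- Valid for every k because 1/Γ is entire; at k + 1 = m both sides vanish. -/
theorem legCoeff_succ (m k : ℕ) (ν : ℂ) : (k + 1) * (k + 1 - m) * legCoeff m (k + 1) ν =
    (k - ν) * (k + ν + 1) * legCoeff m k ν := by
  have h1 := regCoeff_eq m k
  have h2 := regCoeff_eq m (k + 1)
  have h3 := Complex.one_div_Gamma_eq_self_mul_one_div_Gamma_add_one (1 - m + k : ℂ)
  have e1 : (k.factorial : ℂ) ≠ 0 := by exact_mod_cast Nat.factorial_ne_zero _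
  have e2 : (k + 1 : ℂ) ≠ 0 := by exact_mod_cast Nat.succ_ne_zero k
  have h4 : (k + 1) * (k + 1 - m) * regCoeff m (k + 1) = regCoeff m k := by
    rw [← h1, ← h2, h3, Nat.factorial_succ]
    push_cast
    rw [show (1 - m + k + 1 : ℂ) = 1 - m + (k + 1) by ring]
    field_simp
    ring
  rw [legCoeff, legCoeff, ascPochhammer_succ_eval, ascPochhammer_succ_eval, ← h4]
  ring

/-- The ν-derivative of (k - ν)(k + ν + 1) is -(2ν + 1), the source of the inhomogeneity. -/
theorem deriv_legCoeff_succ (m n k : ℕ) :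
    (k + 1) * (k + 1 - m) * deriv (legCoeff m (k + 1)) n =
      (k - n) * (k + n + 1) * deriv (legCoeff m k) n - (2 * n + 1) * legCoeff m k n := by
  have h1 := ((differentiable_legCoeff m (k + 1)) n).hasDerivAt.const_mul
    ((k + 1) * (k + 1 - m) : ℂ)
  have h2 : HasDerivAt (fun ν : ℂ => (k - ν) * (k + ν + 1)) (-(2 * n + 1)) n := by
    have := ((hasDerivAt_id (n : ℂ)).const_sub (k : ℂ)).mul
      (((hasDerivAt_id (n : ℂ)).const_add (k : ℂ)).add_const 1)
    refine this.congr_deriv ?_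
    simp only [id_eq]; ring
  have h3 := h2.mul ((differentiable_legCoeff m k) n).hasDerivAt
  have e : (fun ν => (k + 1) * (k + 1 - m) * legCoeff m (k + 1) ν) =
      (fun ν : ℂ => (k - ν) * (k + ν + 1)) * legCoeff m k := by
    funext ν; exact legCoeff_succ m k ν
  rw [e] at h1
  have := h1.unique h3
  rw [this]
  ring

end

/-! ### The derivative in the degree in finite terms. -/

noncomputable section

theorem hasSum_coeff_mul {f g : PowerSeries ℂ} {w a b : ℂ}
    (hf : HasSum (fun k => PowerSeries.coeff k f * w ^ k) a)
    (hg : HasSum (fun k => PowerSeries.coeff k g * w ^ k) b) :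
    HasSum (fun k => PowerSeries.coeff k (f * g) * w ^ k) (a * b) := by
  have h := (summable_norm_sum_mul_antidiagonal_of_summable_norm hf.summable.norm
    hg.summable.norm).of_norm.hasSum
  rw [← tsum_mul_tsum_eq_tsum_sum_antidiagonal_of_summable_norm hf.summable.norm
    hg.summable.norm, hf.tsum_eq, hg.tsum_eq] at h
  have e (k : ℕ) : PowerSeries.coeff k (f * g) * w ^ k = ∑ p ∈ Finset.HasAntidiagonal.antidiagonal k,
      PowerSeries.coeff p.1 f * w ^ p.1 * (PowerSeries.coeff p.2 g * w ^ p.2) := by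
    rw [PowerSeries.coeff_mul, Finset.sum_mul]
    refine Finset.sum_congr rfl fun p hp => ?_
    rw [← Finset.HasAntidiagonal.mem_antidiagonal.1 hp, pow_add]; ring
  rw [funext e]
  exact h

theorem hasSum_coeff_coe (p : Polynomial ℂ) (w : ℂ) :
    HasSum (fun k => PowerSeries.coeff k (p : PowerSeries ℂ) * w ^ k) (p.eval w) := by
  rw [Polynomial.eval_eq_sum_range]
  simp only [Polynomial.coeff_coe]
  refine hasSum_sum_of_ne_finset_zero fun k hk => ?_
  rw [Polynomial.coeff_eq_zero_of_natDegree_lt (by simpa using hk), zero_mul]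

theorem hasSum_coeff_logSeries {w : ℂ} (hw : w ∈ Metric.ball (0 : ℂ) 1) :
    HasSum (fun k => PowerSeries.coeff k logSeries * w ^ k) (Complex.log (1 - w)) := by
  have h := (Complex.hasSum_taylorSeries_neg_log (by simpa using hw)).neg
  rw [neg_neg] at h
  have e (k : ℕ) : PowerSeries.coeff k logSeries * w ^ k = -(w ^ k / k) := by
    rw [logSeries, PowerSeries.coeff_mk]; ring
  rw [funext e]
  exact h

theorem legCoeff_of_lt {m k : ℕ} (h : k < m) : legCoeff m k = 0 := by
  funext ν; simp [legCoeff, regCoeff, h]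

theorem ascPochhammer_eval_neg_natCast {n k : ℕ} (h : k ≤ n) :
    (ascPochhammer ℂ k).eval (-n : ℂ) * (n - k).factorial = (-1) ^ k * n.factorial := by
  induction k with
  | zero => simp
  | succ k ih =>
    have h1 : (n - k).factorial = (n - k) * (n - (k + 1)).factorial := by
      rw [show n - k = (n - (k + 1)) + 1 by omega, Nat.factorial_succ]
    have ih := ih (by omega)
    rw [h1] at ih
    push_cast [show k ≤ n by omega] at ih
    rw [ascPochhammer_succ_eval, pow_succ]
    linear_combination -ih

theorem ascPochhammer_eval_natCast_add_one (n k : ℕ) :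
    (ascPochhammer ℂ k).eval (n + 1 : ℂ) * n.factorial = (k + n).factorial := by
  induction k with
  | zero => simp
  | succ k ih =>
    rw [ascPochhammer_succ_eval, show k + 1 + n = (k + n) + 1 by ring, Nat.factorial_succ]
    push_cast
    rw [← ih]; ring

theorem legCoeff_natCast {n m : ℕ} (hmn : m ≤ n) (k : ℕ) :
    legCoeff m (k + m) n = (-1) ^ m * (legF n m 1).coeff k := by
  rw [legF, coeff_hypPoly, legCoeff, regCoeff, if_neg (by omega), Nat.add_sub_cancel,
    Pi.one_apply, mul_one]
  rcases le_or_gt k (n - m) with h | h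
  · have h1 := ascPochhammer_eval_neg_natCast (n := n) (k := k + m) (by omega)
    have h2 := ascPochhammer_eval_natCast_add_one n (k + m)
    have e0 : (n.factorial : ℂ) ≠ 0 := by exact_mod_cast Nat.factorial_ne_zero _
    have e1 : ((n - (k + m)).factorial : ℂ) ≠ 0 := by exact_mod_cast Nat.factorial_ne_zero _
    rw [hypCoeff_of_le h, show n - m - k = n - (k + m) by omega,
      show k + (n + m) = k + m + n by ring, eq_div_of_mul_eq e1 h1, eq_div_of_mul_eq e0 h2, pow_add]
    have e2 : (k.factorial : ℂ) ≠ 0 := by exact_mod_cast Nat.factorial_ne_zero _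
    have e3 : ((k + m).factorial : ℂ) ≠ 0 := by exact_mod_cast Nat.factorial_ne_zero _
    field_simp
  · rw [hypCoeff_of_lt h, ascPochhammer_eval_neg_coe_nat_of_lt (by omega)]; simp

/-- The reduced power series of the derivative in the degree. -/
def derivSeries (n m : ℕ) : PowerSeries ℂ :=
  PowerSeries.mk fun k => (-1) ^ m * deriv (legCoeff m (k + m)) n

theorem seriesHyp_derivSeries {n m : ℕ} (hmn : m ≤ n) :
    seriesHyp (m - n) (n + m + 1) (1 + m) (derivSeries n m) =
      -(2 * n + 1) * (legF n m 1 : PowerSeries ℂ) := by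
  have e : (-(2 * n + 1) * (legF n m 1 : PowerSeries ℂ)) =
      PowerSeries.C (-(2 * n + 1) : ℂ) * (legF n m 1 : PowerSeries ℂ) := by
    rw [map_neg, map_add, map_mul, map_ofNat, map_natCast, map_one]
  rw [e]
  ext k
  rw [coeff_seriesHyp, PowerSeries.coeff_C_mul, Polynomial.coeff_coe, derivSeries,
    PowerSeries.coeff_mk, PowerSeries.coeff_mk]
  have h1 := deriv_legCoeff_succ m n (k + m)
  have h2 := legCoeff_natCast hmn k
  rw [h2, show k + m + 1 = k + 1 + m by ring] at h1
  have h3 : ((-1) ^ m * (-1) ^ m : ℂ) = 1 := by rw [← mul_pow]; simp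
  push_cast at h1
  linear_combination (-1) ^ m * h1 - (2 * n + 1) * (legF n m 1).coeff k * h3

theorem hasSum_derivSeries (n m : ℕ) {w : ℂ} (hw : w ∈ Metric.ball (0 : ℂ) 1) (hw0 : w ≠ 0) :
    HasSum (fun k => PowerSeries.coeff k (derivSeries n m) * w ^ k)
      ((-1) ^ m * legHypDeriv n m w / w ^ m) := by
  have h := ((hasSum_nat_add_iff' m).2 (hasSum_legHypDeriv n m hw)).mul_left ((-1) ^ m / w ^ m)
  rw [Finset.sum_eq_zero, sub_zero] at h
  · have e (k : ℕ) : PowerSeries.coeff k (derivSeries n m) * w ^ k =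
        (-1) ^ m / w ^ m * (deriv (legCoeff m (k + m)) n * w ^ (k + m)) := by
      rw [derivSeries, PowerSeries.coeff_mk, pow_add]; field_simp
    rw [funext e, mul_div_right_comm]
    exact h
  · intro k hk
    have h0 : deriv (0 : ℂ → ℂ) (n : ℂ) = 0 := deriv_const _ (0 : ℂ)
    rw [legCoeff_of_lt (Finset.mem_range.1 hk), h0, zero_mul]

/-- The derivative of `P_ν^m` in the degree at `n`, in finite terms. -/
theorem exists_legHypDeriv_eq {n m : ℕ} (hmn : m ≤ n) : ∃ s, IsLegS n m s ∧ ∀ w ∈ hypDomain,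
    (1 - w) ^ m * legHypDeriv n m w =
      (-1) ^ m * w ^ m * ((legR n m 1).eval w * Complex.log (1 - w) + s.eval w) := by
  obtain ⟨s, hs, hD⟩ := exists_eq_log_add hmn (seriesHyp_derivSeries hmn)
  refine ⟨s, hs, ?_⟩
  have h3 : ((-1) ^ m * (-1) ^ m : ℂ) = 1 := by rw [← mul_pow]; simp
  -- The series for the derivative is divided by w^m, so the identity is first obtained off the
  -- origin; the identity theorem then extends it to the cut plane.
  have hball : ∀ w ∈ Metric.ball (0 : ℂ) 1, w ≠ 0 → (1 - w) ^ m * legHypDeriv n m w =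
      (-1) ^ m * w ^ m * ((legR n m 1).eval w * Complex.log (1 - w) + s.eval w) := by
    intro w hw hw0
    have h1 := hasSum_coeff_mul (hasSum_coeff_coe ((1 - Polynomial.X) ^ m) w)
      (hasSum_derivSeries n m hw hw0)
    have h2 := (hasSum_coeff_mul (hasSum_coeff_coe (legR n m 1) w)
      (hasSum_coeff_logSeries hw)).add (hasSum_coeff_coe s w)
    simp only [← add_mul, ← map_add] at h2
    rw [← hD] at h2
    simp only [Polynomial.coe_pow, Polynomial.coe_sub, Polynomial.coe_one, Polynomial.coe_X] at h1
    have h4 := h1.unique h2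
    rw [Polynomial.eval_pow, Polynomial.eval_sub, Polynomial.eval_one, Polynomial.eval_X] at h4
    rw [← h4]
    field_simp
    linear_combination -((1 - w) ^ m * legHypDeriv n m w) * h3
  have hlog : DifferentiableOn ℂ (fun w : ℂ => Complex.log (1 - w)) hypDomain := fun w hw =>
    ((by fun_prop : DifferentiableAt ℂ (fun w : ℂ => 1 - w) w).clog hw).differentiableWithinAt
  have hpoly (p : Polynomial ℂ) : DifferentiableOn ℂ (fun w => p.eval w) hypDomain :=
    p.differentiable.differentiableOn
  have hL : DifferentiableOn ℂ (fun w => (1 - w) ^ m * legHypDeriv n m w) hypDomain :=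
    (by fun_prop : DifferentiableOn ℂ (fun w : ℂ => (1 - w) ^ m) hypDomain).mul
      (differentiableOn_legHypDeriv n m)
  have hR : DifferentiableOn ℂ (fun w => (-1) ^ m * w ^ m *
      ((legR n m 1).eval w * Complex.log (1 - w) + s.eval w)) hypDomain :=
    (by fun_prop : DifferentiableOn ℂ (fun w : ℂ => (-1) ^ m * w ^ m) hypDomain).mul
      (((hpoly _).mul hlog).add (hpoly s))
  refine (hL.analyticOnNhd isOpen_hypDomain).eqOn_of_preconnected_of_frequently_eq
    (hR.analyticOnNhd isOpen_hypDomain) isPreconnected_hypDomain zero_mem_hypDomain ?_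
  refine Filter.Eventually.frequently ?_
  filter_upwards [nhdsWithin_le_nhds (Metric.ball_mem_nhds (0 : ℂ) one_pos),
    self_mem_nhdsWithin] with w hw hw0
  exact hball w hw hw0

theorem eval_hypPoly (N B m : ℕ) (θ : ℕ → ℂ) (w : ℂ) : (hypPoly N B m θ).eval w =
    ∑ k ∈ Finset.range (N + 1), hypCoeff N B m k * θ k * w ^ k := by
  simp [hypPoly, Polynomial.eval_finsetSum]

theorem regHyp_nat_eq {n m : ℕ} (hmn : m ≤ n) {w : ℂ} (hw : w ∈ hypDomain) :
    regHyp (-n) (n + 1) (1 - m) w = (-1) ^ m * w ^ m * (legF n m 1).eval w := by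
  rw [regHyp_nat n m hw, show n + 1 = m + (n - m + 1) by omega, Finset.sum_range_add,
    Finset.sum_eq_zero, zero_add, legF, eval_hypPoly, Finset.mul_sum]
  · refine Finset.sum_congr rfl fun k _ => ?_
    rw [add_comm m k, legCoeff_natCast hmn, legF, coeff_hypPoly, pow_add]
    ring
  · intro k hk
    rw [legCoeff_of_lt (Finset.mem_range.1 hk)]; simp

end

/-! ### Branches of logarithms and powers, and l'Hôpital's rule. -/

noncomputable section

theorem tendsto_div_of_hasDerivAt {f g : ℂ → ℂ} {f' g' x : ℂ} (hf : HasDerivAt f f' x)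
    (hg : HasDerivAt g g' x) (hf0 : f x = 0) (hg0 : g x = 0) (h : g' ≠ 0) :
    Tendsto (fun y => f y / g y) (𝓝[≠] x) (𝓝 (f' / g')) := by
  rw [hasDerivAt_iff_tendsto_slope] at hf hg
  refine (hf.div hg h).congr' ?_
  filter_upwards [self_mem_nhdsWithin] with y hy
  have : y - x ≠ 0 := sub_ne_zero.2 hy
  rw [Pi.div_apply, slope_def_field, slope_def_field, hf0, hg0, sub_zero, sub_zero]
  field_simp

theorem log_neg_of_im_pos {x : ℂ} (h : 0 < x.im) :
    Complex.log (-x) = Complex.log x - Complex.I * Real.pi := by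
  rw [Complex.log, Complex.log, norm_neg, Complex.arg_neg_eq_arg_sub_pi_of_im_pos h]
  push_cast; ring

theorem log_neg_of_im_neg {x : ℂ} (h : x.im < 0) :
    Complex.log (-x) = Complex.log x + Complex.I * Real.pi := by
  rw [Complex.log, Complex.log, norm_neg, Complex.arg_neg_eq_arg_add_pi_of_im_neg h]
  push_cast; ring

theorem log_div_of_im {x y : ℂ} (h : (0 < x.im ∧ 0 < y.im) ∨ (x.im < 0 ∧ y.im < 0)) :
    Complex.log (x / y) = Complex.log x - Complex.log y := by
  have hx : x ≠ 0 := by rintro rfl; simp at h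
  have hy : y ≠ 0 := by rintro rfl; simp at h
  have hbound : -Real.pi < x.arg - y.arg ∧ x.arg - y.arg ≤ Real.pi := by
    rcases h with ⟨h1, h2⟩ | ⟨h1, h2⟩
    · have a1 := Complex.arg_nonneg_iff.2 h1.le
      have a2 := Complex.arg_nonneg_iff.2 h2.le
      have a3 := Complex.arg_le_pi x
      have a4 : y.arg < Real.pi := Complex.arg_lt_pi_iff.2 (Or.inr h2.ne')
      constructor <;> linarith
    · have a1 := Complex.arg_neg_iff.2 h1
      have a2 := Complex.arg_neg_iff.2 h2
      have a3 := Complex.neg_pi_lt_arg x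
      have a4 := Complex.neg_pi_lt_arg y
      constructor <;> linarith
  have e : x / y = Complex.exp (Complex.log x - Complex.log y) := by
    rw [Complex.exp_sub, Complex.exp_log hx, Complex.exp_log hy]
  rw [e, Complex.log_exp]
  · rw [Complex.sub_im, Complex.log_im, Complex.log_im]; exact hbound.1
  · rw [Complex.sub_im, Complex.log_im, Complex.log_im]; exact hbound.2

/-- The exponent `∓ i π` in the definition of `Q`. -/
def legPhase (z : ℂ) : ℂ := if 0 < z.im then -(Complex.I * Real.pi) else Complex.I * Real.pi

theorem log_neg_eq_add_legPhase {x z : ℂ} (hx : x.im = z.im) (hz : z.im ≠ 0) :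
    Complex.log (-x) = Complex.log x + legPhase z := by
  rw [legPhase]
  split_ifs with h
  · rw [log_neg_of_im_pos (hx ▸ h)]; ring
  · exact log_neg_of_im_neg (hx ▸ lt_of_le_of_ne (not_lt.1 h) hz)

/-- Both logarithms shift by the same phase, which cancels in the quotient. -/
theorem neg_cpow_div_neg_cpow {x y z : ℂ} (hx : x.im = z.im) (hy : y.im = z.im)
    (hz : z.im ≠ 0) (a : ℂ) : (-x) ^ a / (-y) ^ a = x ^ a / y ^ a := by
  have hx0 : x ≠ 0 := by rintro rfl; exact hz (by simpa using hx.symm)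
  have hy0 : y ≠ 0 := by rintro rfl; exact hz (by simpa using hy.symm)
  rw [Complex.cpow_def_of_ne_zero hx0, Complex.cpow_def_of_ne_zero hy0,
    Complex.cpow_def_of_ne_zero (neg_ne_zero.2 hx0), Complex.cpow_def_of_ne_zero (neg_ne_zero.2 hy0),
    ← Complex.exp_sub, ← Complex.exp_sub, log_neg_eq_add_legPhase hx hz,
    log_neg_eq_add_legPhase hy hz]
  congr 1; ring

/-- This merges the phase ∓iπ from the definition of Q with the logarithms contributed by P_ν^m(z)
and P_ν^m(-z). -/
theorem log_quotient_eq {z : ℂ} (hz : z.im ≠ 0) : Complex.log ((z + 1) / (z - 1)) =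
    legPhase z + Complex.log (1 - (1 - z) / 2) - Complex.log ((1 - z) / 2) := by
  have h1 : z + 1 ≠ 0 := fun h => hz (by simpa using congrArg Complex.im h)
  have h2 : -(z - 1) ≠ 0 := fun h => hz (by simpa using congrArg Complex.im h)
  have e1 : 1 - (1 - z) / 2 = ((1 / 2 : ℝ) : ℂ) * (z + 1) := by push_cast; ring
  have e2 : (1 - z) / 2 = ((1 / 2 : ℝ) : ℂ) * -(z - 1) := by push_cast; ring
  rw [e1, e2, Complex.log_ofReal_mul (by norm_num) h1, Complex.log_ofReal_mul (by norm_num) h2,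
    log_neg_eq_add_legPhase (z := z) (by simp) hz, log_div_of_im]
  · ring
  · rcases lt_or_gt_of_ne hz with h | h
    · right; simpa using h
    · left; simpa using h

theorem cpow_half_mul_self {x : ℂ} (hx : x ≠ 0) (m : ℕ) :
    x ^ ((m : ℂ) / 2) * x ^ ((m : ℂ) / 2) = x ^ m := by
  rw [← Complex.cpow_add _ _ hx, add_halves, Complex.cpow_natCast]

theorem cpow_ne_zero_of_ne {x : ℂ} (hx : x ≠ 0) (a : ℂ) : x ^ a ≠ 0 := by
  rw [Ne, Complex.cpow_eq_zero_iff]; exact fun h => hx h.1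

/-- `Q_n^m` in finite terms, with the polynomial `s` of `IsLegS`. -/
def legQClosed (n m : ℕ) (s : Polynomial ℂ) (z : ℂ) : ℂ :=
  1 / 2 * ((z + 1) ^ ((m : ℂ) / 2) / (z - 1) ^ ((m : ℂ) / 2)) * (-1) ^ m *
    (((1 - z) / 2) ^ m * (legF n m 1).eval ((1 - z) / 2) * Complex.log ((z + 1) / (z - 1)) +
      (((1 - z) / 2) ^ m * s.eval ((1 - z) / 2)
        - (-1) ^ (n + m) * (1 - (1 - z) / 2) ^ m * s.eval (1 - (1 - z) / 2))
        / (1 - (1 - z) / 2) ^ m)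

theorem half_mem_hypDomain {z : ℂ} (hz : z.im ≠ 0) :
    (1 - z) / 2 ∈ hypDomain ∧ (1 - -z) / 2 ∈ hypDomain := by
  constructor <;> refine Complex.mem_slitPlane_iff.2 (Or.inr ?_)
  · have : (1 - (1 - z) / 2).im = z.im / 2 := by simp; ring
    rw [this]; exact div_ne_zero hz two_ne_zero
  · have : (1 - (1 - -z) / 2).im = -(z.im / 2) := by simp
    rw [this]; exact neg_ne_zero.2 (div_ne_zero hz two_ne_zero)

/-- The numerator vanishes at ν = n by `legF_comp`. In its derivative the phase, log(1 - w) and log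
w carry the same coefficient up to sign and combine into one logarithm; the polynomial s contributes
at w and at 1 - w. -/
theorem tendsto_legendreQuot {n m : ℕ} (hmn : m ≤ n) {s : Polynomial ℂ}
    (hs : ∀ w ∈ hypDomain, (1 - w) ^ m * legHypDeriv n m w =
      (-1) ^ m * w ^ m * ((legR n m 1).eval w * Complex.log (1 - w) + s.eval w))
    {z : ℂ} (hz : z.im ≠ 0) :
    Tendsto (fun ν => legendreQuot ν m z) (𝓝[≠] (n : ℂ)) (𝓝 (legQClosed n m s z)) := by
  obtain ⟨hw1, hw2⟩ := half_mem_hypDomain hz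
  have hz1 : z + 1 ≠ 0 := fun h => hz (by simpa using congrArg Complex.im h)
  have hz2 : z - 1 ≠ 0 := fun h => hz (by simpa using congrArg Complex.im h)
  have hpi : (Real.pi : ℂ) ≠ 0 := by exact_mod_cast Real.pi_ne_zero
  have hX0 := cpow_ne_zero_of_ne hz2 ((m : ℂ) / 2)
  have hY0 := cpow_ne_zero_of_ne hz1 ((m : ℂ) / 2)
  have hX := cpow_half_mul_self hz2 m
  have hY := cpow_half_mul_self hz1 m
  have hA := neg_cpow_div_neg_cpow (x := z - 1) (y := z + 1) (by simp) (by simp) hz ((m : ℂ) / 2)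
  have hlog := log_quotient_eq hz
  rw [neg_sub, neg_add] at hA
  have hN : ∀ ν : ℂ, legendreQuot ν m z = (Real.pi / 2 * (-1) ^ m) *
      ((Complex.exp (legPhase z * ν) * legendreP ν m z - legendreP ν m (-z)) /
        Complex.sin (Real.pi * (ν + m))) := by
    intro ν
    have h1 : Complex.exp (Complex.I * Real.pi * m) = (-1) ^ m := by
      rw [← Complex.exp_pi_mul_I, ← Complex.exp_nat_mul]; congr 1; ring
    have h2 : (if 0 < z.im then Complex.exp (-(Complex.I * Real.pi * ν))
        else Complex.exp (Complex.I * Real.pi * ν)) = Complex.exp (legPhase z * ν) := by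
      rw [legPhase]; split_ifs <;> ring_nf
    rw [legendreQuot, h1, h2, mul_div_assoc]
  simp only [hN]
  have hexp : Complex.exp (legPhase z * n) = (-1) ^ n := by
    rw [legPhase]
    split_ifs
    · rw [show -(Complex.I * Real.pi) * n = n * -(Real.pi * Complex.I) by ring,
        Complex.exp_nat_mul, Complex.exp_neg, Complex.exp_pi_mul_I]; norm_num
    · rw [show Complex.I * Real.pi * n = n * (Real.pi * Complex.I) by ring,
        Complex.exp_nat_mul, Complex.exp_pi_mul_I]
  have hd1 := (hasDerivAt_regHyp n m hw1).const_mul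
    ((z + 1) ^ ((m : ℂ) / 2) / (z - 1) ^ ((m : ℂ) / 2))
  have hd2 := (hasDerivAt_regHyp n m hw2).const_mul
    ((-z + 1) ^ ((m : ℂ) / 2) / (-z - 1) ^ ((m : ℂ) / 2))
  have hd3 := ((hasDerivAt_id (n : ℂ)).const_mul (legPhase z)).cexp
  have hds := (((hasDerivAt_id (n : ℂ)).add_const (m : ℂ)).const_mul (Real.pi : ℂ)).csin
  have hsin : Complex.sin (Real.pi * ((n : ℂ) + m)) = 0 := by
    rw [mul_comm]; exact_mod_cast Complex.sin_nat_mul_pi (n + m)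
  have hcos : Complex.cos (Real.pi * ((n : ℂ) + m)) = (-1) ^ (n + m) := by
    rw [mul_comm]; exact_mod_cast complex_cos_nat_mul_pi (n + m)
  have hcomp : (legF n m 1).eval ((1 - -z) / 2) =
      (-1) ^ (n + m) * (legF n m 1).eval ((1 - z) / 2) := by
    have := congrArg (Polynomial.eval ((1 - z) / 2)) (legF_comp hmn)
    rw [Polynomial.eval_comp, Polynomial.eval_mul, Polynomial.eval_C] at this
    rw [← this]
    congr 1
    simp; ring
  have hE1 := hs _ hw1
  have hE2 := hs _ hw2
  have hr (w : ℂ) : (legR n m 1).eval w = (1 - w) ^ m * (legF n m 1).eval w := by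
    rw [legR_eq hmn]; simp
  rw [hr] at hE1 hE2
  have hp1 := regHyp_nat_eq hmn hw1
  have hp2 := regHyp_nat_eq hmn hw2
  rw [hcomp] at hE2 hp2
  have e1 : (1 - -z) / 2 = 1 - (1 - z) / 2 := by ring
  have hw0 : (1 - z) / 2 ≠ 0 := fun h => hz2 (by linear_combination -2 * h)
  have hw0' : 1 - (1 - z) / 2 ≠ 0 := fun h => hz1 (by linear_combination 2 * h)
  have hXw : (z - 1) ^ m = (-1) ^ m * 2 ^ m * ((1 - z) / 2) ^ m := by
    rw [← mul_pow, ← mul_pow]; congr 1; ring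
  have hYw : (z + 1) ^ m = 2 ^ m * (1 - (1 - z) / 2) ^ m := by
    rw [← mul_pow]; congr 1; ring
  rw [hXw] at hX
  rw [hYw] at hY
  have h2m : (2 : ℂ) ^ m ≠ 0 := pow_ne_zero _ two_ne_zero
  have hwm := pow_ne_zero m hw0
  have hwm' := pow_ne_zero m hw0'
  have hNd := (hd3.mul hd1).sub hd2
  have hsin' : Complex.cos (Real.pi * (id (n : ℂ) + m)) * (Real.pi * 1) ≠ 0 := by
    rw [id_eq, hcos, mul_one]
    exact mul_ne_zero (pow_ne_zero _ (by norm_num)) hpi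
  -- Passing to -z inverts the prefactor. As half powers square to integer powers, the inverse is
  -- the original prefactor times a rational function of w.
  have hXY : (z - 1) ^ ((m : ℂ) / 2) / (z + 1) ^ ((m : ℂ) / 2) =
      (z + 1) ^ ((m : ℂ) / 2) / (z - 1) ^ ((m : ℂ) / 2) *
        ((-1) ^ m * ((1 - z) / 2) ^ m / (1 - (1 - z) / 2) ^ m) := by
    rw [div_mul_div_comm, div_eq_div_iff hY0 (mul_ne_zero hX0 hwm')]
    linear_combination (1 - (1 - z) / 2) ^ m * hX - (-1) ^ m * ((1 - z) / 2) ^ m * hY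
  have hA' : (-z + 1) ^ ((m : ℂ) / 2) / (-z - 1) ^ ((m : ℂ) / 2) =
      (z - 1) ^ ((m : ℂ) / 2) / (z + 1) ^ ((m : ℂ) / 2) := by
    rw [← hA]; (congr 2; ring)
  rw [hA', hXY] at hNd
  have key := tendsto_div_of_hasDerivAt hNd hds ?_ hsin hsin'
  · have key' := key.const_mul (Real.pi / 2 * (-1) ^ m : ℂ)
    simp only [legendreP, hA', hXY]
    rw [e1, sub_sub_cancel] at hE2
    convert key' using 2
    · simp only [Pi.sub_apply, Pi.mul_apply, id_eq]
    · rw [id_eq, hexp, hcos, hp1, e1, eq_div_of_mul_eq hwm' ((mul_comm _ _).trans hE1),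
        eq_div_of_mul_eq hwm ((mul_comm _ _).trans hE2), legQClosed, hlog]
      generalize (z + 1) ^ ((m : ℂ) / 2) / (z - 1) ^ ((m : ℂ) / 2) = q
      generalize (1 - (1 - z) / 2) ^ m = u at hwm' ⊢
      generalize ((1 - z) / 2) ^ m = v at hwm ⊢
      generalize Polynomial.eval ((1 - z) / 2) (legF n m 1) = x₁
      generalize Polynomial.eval ((1 - z) / 2) s = x₂
      generalize Polynomial.eval (1 - (1 - z) / 2) s = x₃
      generalize Complex.log (1 - (1 - z) / 2) = x₄
      generalize Complex.log ((1 - z) / 2) = x₅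
      rw [pow_add]
      -- The sign cases supply that (-1)^m and (-1)^n square to 1, which `ring` does not know.
      rcases neg_one_pow_eq_or ℂ m with ha | ha <;> rcases neg_one_pow_eq_or ℂ n with hb | hb <;>
        rw [ha, hb] <;> field_simp <;> ring
  · simp only [Pi.sub_apply, Pi.mul_apply, id_eq]
    rw [hexp, hp1, hp2, e1]
    generalize (z + 1) ^ ((m : ℂ) / 2) / (z - 1) ^ ((m : ℂ) / 2) = q
    generalize (1 - (1 - z) / 2) ^ m = u at hwm' ⊢
    generalize ((1 - z) / 2) ^ m = v at hwm ⊢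
    generalize Polynomial.eval ((1 - z) / 2) (legF n m 1) = x₁
    rw [pow_add]
    rcases neg_one_pow_eq_or ℂ m with ha | ha <;> rw [ha] <;> field_simp <;> ring
end

/-! ### Digamma weights and the two sign choices. -/

noncomputable section

/-- The weights `2 ψ(k + n + m + 1) - ψ(k + m + 1)`. -/
def digammaWeightF (n m k : ℕ) : ℂ :=
  2 * Complex.digamma (k + n + m + 1) - Complex.digamma (k + m + 1)

/-- The weights `2 ψ(k + n + 1) - 2 ψ(k + m + 1) - ψ(k + 1)`. -/
def digammaWeightR (n m k : ℕ) : ℂ :=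
  2 * Complex.digamma (k + n + 1) - 2 * Complex.digamma (k + m + 1) - Complex.digamma (k + 1)

/-- The only property of ψ that the proof uses. -/
theorem digamma_natCast_succ_add_one (k : ℕ) :
    Complex.digamma (((k + 1 : ℕ) : ℂ) + 1) = Complex.digamma ((k : ℂ) + 1) + 1 / ((k : ℂ) + 1) := by
  have h := Complex.digamma_apply_add_one ((k : ℂ) + 1) fun j hj => by
    have : ((k + 1 + j : ℕ) : ℂ) = 0 := by push_cast; rw [hj]; ring
    have := Nat.cast_eq_zero.1 this
    omega
  rw [one_div, ← h]
  push_cast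
  rfl

theorem digammaWeightF_succ_sub (n m k : ℕ) :
    digammaWeightF n m (k + 1) - digammaWeightF n m k =
      2 / ((k : ℂ) + n + m + 1) - 1 / ((k : ℂ) + m + 1) := by
  have h1 := digamma_natCast_succ_add_one (k + n + m)
  have h2 := digamma_natCast_succ_add_one (k + m)
  push_cast at h1 h2
  rw [digammaWeightF, digammaWeightF]
  push_cast
  rw [show (k : ℂ) + 1 + n + m + 1 = k + n + m + 1 + 1 by ring,
    show (k : ℂ) + 1 + m + 1 = k + m + 1 + 1 by ring, h1, h2]
  ring

theorem digammaWeightR_succ_sub (n m k : ℕ) :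
    digammaWeightR n m (k + 1) - digammaWeightR n m k =
      2 / ((k : ℂ) + n + 1) - 2 / ((k : ℂ) + m + 1) - 1 / ((k : ℂ) + 1) := by
  have h1 := digamma_natCast_succ_add_one (k + n)
  have h2 := digamma_natCast_succ_add_one (k + m)
  have h3 := digamma_natCast_succ_add_one k
  push_cast at h1 h2 h3
  rw [digammaWeightR, digammaWeightR]
  push_cast
  rw [show (k : ℂ) + 1 + n + 1 = k + n + 1 + 1 by ring,
    show (k : ℂ) + 1 + m + 1 = k + m + 1 + 1 by ring, h1, h2, h3]
  ring

/-- In the top degrees both weights contain 2ψ(2n + 1) - ψ(n + 1). What is left over produces the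
term ψ(n + m + 1) P_n^m. -/
theorem digammaWeightF_sub_digammaWeightR {n m : ℕ} (hmn : m ≤ n) :
    digammaWeightF n m (n - m) - digammaWeightR n m n = 2 * Complex.digamma (n + m + 1) := by
  rw [digammaWeightF, digammaWeightR]
  push_cast [hmn]
  rw [show (n : ℂ) - m + n + m + 1 = n + n + 1 by ring, show (n : ℂ) - m + m + 1 = n + 1 by ring]
  ring

/-- `legF_combination` for the digamma weights, at a point. -/
theorem eval_legF_combination {n m : ℕ} (hmn : m ≤ n) {s : Polynomial ℂ} (hs : IsLegS n m s)
    (v : ℂ) :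
    v ^ m * (1 - v) ^ m * ((legF n m (digammaWeightF n m)).eval v
        - 2 * Complex.digamma (n + m + 1) * (legF n m 1).eval v)
      - v ^ m * (legR n m (digammaWeightR n m)).eval v + (legSing n m).eval v =
    v ^ m * s.eval v - (-1) ^ (n + m) * ((1 - v) ^ m * s.eval (1 - v)) := by
  have h := congrArg (Polynomial.eval v) (legF_combination hmn hs (digammaWeightF_succ_sub n m)
    (digammaWeightR_succ_sub n m) (digammaWeightF_sub_digammaWeightR hmn))
  simpa using h

/-- As ε² = 1, (1 - εz)/2 = -ε (z - ε)/2; both sign choices are thus values of one polynomial, at w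
and at 1 - w. -/
theorem sum_eq_eval_legSing (n m : ℕ) {ε : ℂ} (hε : ε * ε = 1) (z : ℂ) :
    ((n + m).factorial / (n - m).factorial : ℂ) * ∑ k ∈ Finset.range m,
      (-ε) ^ k * ((k + n - m).factorial * (m - k - 1).factorial : ℂ)
        / (k.factorial * (n + m - k).factorial : ℂ) * ((z - ε) / 2) ^ k =
      (legSing n m).eval ((1 - ε * z) / 2) := by
  have hv : (1 - ε * z) / 2 = -ε * ((z - ε) / 2) := by linear_combination -(1 / 2) * hε
  rw [legSing, Polynomial.eval_finsetSum, Finset.mul_sum, hv]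
  refine Finset.sum_congr rfl fun k _ => ?_
  simp only [Polynomial.eval_mul, Polynomial.eval_C, Polynomial.eval_pow, Polynomial.eval_X]
  rw [mul_pow]
  ring

theorem pow_mul_sub_half_pow {ε : ℂ} (hε : ε * ε = 1) (z : ℂ) (k : ℕ) :
    (-1) ^ k * ((1 - ε * z) / 2) ^ k = ε ^ k * ((z - ε) / 2) ^ k := by
  rw [← mul_pow, ← mul_pow]
  congr 1
  linear_combination (1 / 2) * hε

theorem sum_eq_eval_legF (n m : ℕ) {ε : ℂ} (hε : ε * ε = 1) (z : ℂ) :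
    ∑ k ∈ Finset.range (n - m + 1), ε ^ k * ((k + n + m).factorial : ℂ)
        / (k.factorial * (k + m).factorial * (n - m - k).factorial : ℂ)
        * (2 * Complex.digamma (k + n + m + 1) - Complex.digamma (k + m + 1)) * ((z - ε) / 2) ^ k =
      (legF n m (digammaWeightF n m)).eval ((1 - ε * z) / 2) := by
  rw [legF, eval_hypPoly]
  refine Finset.sum_congr rfl fun k hk => ?_
  rw [hypCoeff_of_le (Nat.lt_succ_iff.1 (Finset.mem_range.1 hk)), digammaWeightF, ← add_assoc k n m]
  linear_combination -((k + n + m).factorial /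
    (k.factorial * (k + m).factorial * (n - m - k).factorial) *
    (2 * Complex.digamma (k + n + m + 1) - Complex.digamma (k + m + 1))) *
    pow_mul_sub_half_pow hε z k

theorem sum_eq_eval_legR (n m : ℕ) {ε : ℂ} (hε : ε * ε = 1) (z : ℂ) :
    ((n + m).factorial / (n - m).factorial : ℂ) * ∑ k ∈ Finset.range (n + 1),
      ε ^ k * ((k + n).factorial : ℂ)
        / (k.factorial * (k + m).factorial * (n - k).factorial : ℂ)
        * (2 * Complex.digamma (k + n + 1) - 2 * Complex.digamma (k + m + 1)
          - Complex.digamma (k + 1)) * ((z - ε) / 2) ^ k =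
      (legR n m (digammaWeightR n m)).eval ((1 - ε * z) / 2) := by
  rw [legR, Polynomial.eval_mul, Polynomial.eval_C, eval_hypPoly]
  congr 1
  refine Finset.sum_congr rfl fun k hk => ?_
  rw [hypCoeff_of_le (Nat.lt_succ_iff.1 (Finset.mem_range.1 hk)), digammaWeightR]
  linear_combination -((k + n).factorial /
    (k.factorial * (k + m).factorial * (n - k).factorial) *
    (2 * Complex.digamma (k + n + 1) - 2 * Complex.digamma (k + m + 1)
      - Complex.digamma (k + 1))) * pow_mul_sub_half_pow hε z k

theorem add_one_mem_slitPlane {z : ℂ} (hz : z ∈ legendreDomain) : z + 1 ∈ Complex.slitPlane := by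
  rcases Complex.mem_slitPlane_iff.1 (show z - 1 ∈ Complex.slitPlane from hz) with h | h
  · refine Complex.mem_slitPlane_iff.2 (Or.inl ?_)
    simp at h ⊢
    linarith
  · exact Complex.mem_slitPlane_iff.2 (Or.inr (by simpa using h))

theorem half_mem_hypDomain_of_mem {z : ℂ} (hz : z ∈ legendreDomain) : (1 - z) / 2 ∈ hypDomain := by
  have e : 1 - (1 - z) / 2 = ((1 / 2 : ℝ) : ℂ) * (z + 1) := by push_cast; ring
  change 1 - (1 - z) / 2 ∈ Complex.slitPlane
  rw [e, Complex.mem_slitPlane_iff]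
  rcases Complex.mem_slitPlane_iff.1 (add_one_mem_slitPlane hz) with h | h
  · left
    rw [Complex.re_ofReal_mul]
    positivity
  · right
    rw [Complex.im_ofReal_mul]
    exact mul_ne_zero (by norm_num) h

theorem legendreP_nat_eq {n m : ℕ} (hmn : m ≤ n) {z : ℂ} (hz : z ∈ legendreDomain) :
    legendreP n m z = (z + 1) ^ ((m : ℂ) / 2) / (z - 1) ^ ((m : ℂ) / 2) *
      ((-1) ^ m * ((1 - z) / 2) ^ m * (legF n m 1).eval ((1 - z) / 2)) := by
  rw [legendreP, regHyp_nat_eq hmn (half_mem_hypDomain_of_mem hz)]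

theorem legendreQ_of_im_ne_zero {n m : ℕ} (hmn : m ≤ n) {s : Polynomial ℂ}
    (hs : ∀ w ∈ hypDomain, (1 - w) ^ m * legHypDeriv n m w =
      (-1) ^ m * w ^ m * ((legR n m 1).eval w * Complex.log (1 - w) + s.eval w))
    {z : ℂ} (hz : z.im ≠ 0) : legendreQ n m z = legQClosed n m s z := by
  rw [legendreQ, if_pos hz, legendreQNonreal]
  exact (tendsto_legendreQuot hmn hs hz).limUnder_eq

theorem one_lt_re_of_im_eq_zero {z : ℂ} (hz : z ∈ legendreDomain) (h0 : z.im = 0) : 1 < z.re := by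
  rcases Complex.mem_slitPlane_iff.1 (show z - 1 ∈ Complex.slitPlane from hz) with h | h
  · simpa using h
  · simp [h0] at h

theorem continuousAt_legQClosed (n m : ℕ) (s : Polynomial ℂ) {z : ℂ} (hz : z ∈ legendreDomain)
    (h0 : z.im = 0) : ContinuousAt (legQClosed n m s) z := by
  have h1 := one_lt_re_of_im_eq_zero hz h0
  have hz1 : z - 1 ≠ 0 := Complex.slitPlane_ne_zero hz
  have hz2 : 1 - (1 - z) / 2 ≠ 0 := Complex.slitPlane_ne_zero (half_mem_hypDomain_of_mem hz)
  have hlog : (z + 1) / (z - 1) ∈ Complex.slitPlane := by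
    have e : z = (z.re : ℂ) := Complex.ext (by simp) (by simp [h0])
    have e' : (z + 1) / (z - 1) = (((z.re + 1) / (z.re - 1) : ℝ) : ℂ) := by
      rw [e]; push_cast; simp
    rw [e', Complex.ofReal_mem_slitPlane]
    exact div_pos (by linarith) (by linarith)
  have hp : ContinuousAt (fun y : ℂ => (y + 1) ^ ((m : ℂ) / 2)) z :=
    ContinuousAt.cpow (by fun_prop) continuousAt_const (add_one_mem_slitPlane hz)
  have hm : ContinuousAt (fun y : ℂ => (y - 1) ^ ((m : ℂ) / 2)) z :=
    ContinuousAt.cpow (by fun_prop) continuousAt_const hz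
  have hl : ContinuousAt (fun y : ℂ => Complex.log ((y + 1) / (y - 1))) z :=
    ContinuousAt.clog (ContinuousAt.div (by fun_prop) (by fun_prop) hz1) hlog
  have hev (p : Polynomial ℂ) (g : ℂ → ℂ) (hg : Continuous g) :
      ContinuousAt (fun y => p.eval (g y)) z := (p.continuous.comp hg).continuousAt
  have a1 := hev (legF n m 1) (fun y => (1 - y) / 2) (by fun_prop)
  have a2 := hev s (fun y => (1 - y) / 2) (by fun_prop)
  have a3 := hev s (fun y => 1 - (1 - y) / 2) (by fun_prop)
  have hw : ContinuousAt (fun y : ℂ => ((1 - y) / 2) ^ m) z := by fun_prop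
  have hw' : ContinuousAt (fun y : ℂ => (1 - (1 - y) / 2) ^ m) z := by fun_prop
  exact ((continuousAt_const.mul (hp.div hm (cpow_ne_zero_of_ne hz1 _))).mul
    continuousAt_const).mul (((hw.mul a1).mul hl).add
      (((hw.mul a2).sub ((continuousAt_const.mul hw').mul a3)).div hw' (pow_ne_zero _ hz2)))

theorem nhdsWithin_im_ne_zero_neBot {z : ℂ} (h0 : z.im = 0) :
    (𝓝[{w : ℂ | w.im ≠ 0}] z).NeBot := by
  rw [← mem_closure_iff_nhdsWithin_neBot]
  have h : z ∈ closure {w : ℂ | 0 < w.im} := by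
    rw [Complex.closure_setOfPred_lt_im]; exact h0.ge
  refine closure_mono ?_ h
  intro w hw
  exact ne_of_gt (show 0 < w.im from hw)

theorem tendsto_legQClosed (n m : ℕ) (s : Polynomial ℂ) {z : ℂ} (hz : z ∈ legendreDomain)
    (h0 : z.im = 0) :
    Tendsto (legQClosed n m s) (𝓝[{w : ℂ | w.im ≠ 0}] z) (𝓝 (legQClosed n m s z)) :=
  (continuousAt_legQClosed n m s hz h0).tendsto.mono_left nhdsWithin_le_nhds

theorem legendreQ_eq_legQClosed {n m : ℕ} (hmn : m ≤ n) {s : Polynomial ℂ}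
    (hs : ∀ w ∈ hypDomain, (1 - w) ^ m * legHypDeriv n m w =
      (-1) ^ m * w ^ m * ((legR n m 1).eval w * Complex.log (1 - w) + s.eval w))
    {z : ℂ} (hz : z ∈ legendreDomain) : legendreQ n m z = legQClosed n m s z := by
  by_cases h0 : z.im = 0
  · rw [legendreQ, if_neg (not_not.2 h0)]
    have := nhdsWithin_im_ne_zero_neBot h0
    refine Tendsto.limUnder_eq ((tendsto_legQClosed n m s hz h0).congr' ?_)
    filter_upwards [self_mem_nhdsWithin] with w hw
    rw [← legendreQ_of_im_ne_zero hmn hs hw, legendreQ, if_pos hw]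
  · exact legendreQ_of_im_ne_zero hmn hs h0

theorem tendsto_legendreQ_of_im_eq_zero {n m : ℕ} (hmn : m ≤ n) {z : ℂ} (hz : z ∈ legendreDomain)
    (h0 : z.im = 0) : Tendsto (fun w => legendreQ n m w) (𝓝[{w : ℂ | w.im ≠ 0}] z)
      (𝓝 (legendreQ n m z)) := by
  obtain ⟨s, -, hs⟩ := exists_legHypDeriv_eq hmn
  rw [legendreQ_eq_legQClosed hmn hs hz]
  refine (tendsto_legQClosed n m s hz h0).congr' ?_
  filter_upwards [self_mem_nhdsWithin] with w hw
  exact (legendreQ_of_im_ne_zero hmn hs hw).symm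

theorem tendsto_legendreQuot_legendreQ {n m : ℕ} (hmn : m ≤ n) {z : ℂ} (hz : z.im ≠ 0) :
    Tendsto (fun ν => legendreQuot ν m z) (𝓝[≠] (n : ℂ)) (𝓝 (legendreQ n m z)) := by
  obtain ⟨s, -, hs⟩ := exists_legHypDeriv_eq hmn
  rw [legendreQ_of_im_ne_zero hmn hs hz]
  exact tendsto_legendreQuot hmn hs hz

/-- `Q_n^m` in terms of polynomials in `(1 - ε z) / 2`. -/
theorem legendreQ_eq {n m : ℕ} (hmn : m ≤ n) {z : ℂ} (hz : z ∈ legendreDomain) {ε : ℂ}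
    (hε : ε = 1 ∨ ε = -1) :
    legendreQ n m z =
      1 / 2 * legendreP n m z * Complex.log ((z + 1) / (z - 1))
      - ε * Complex.digamma (n + m + 1) * legendreP n m z
      + ε * (ε ^ n * (-ε) ^ m / 2)
        * ((z - 1) ^ ((m : ℂ) / 2) * (z + 1) ^ ((m : ℂ) / 2) / 2 ^ m)⁻¹
        * (legSing n m).eval ((1 - ε * z) / 2)
      + ε * (ε ^ (n + m) / 2)
        * ((z - 1) ^ ((m : ℂ) / 2) * (z + 1) ^ ((m : ℂ) / 2) / 2 ^ m)
        * (legF n m (digammaWeightF n m)).eval ((1 - ε * z) / 2)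
      - ε * (ε ^ n / 2)
        * ((z - ε) ^ ((m : ℂ) / 2) / (z + ε) ^ ((m : ℂ) / 2))
        * (legR n m (digammaWeightR n m)).eval ((1 - ε * z) / 2) := by
  obtain ⟨s, hsl, hs⟩ := exists_legHypDeriv_eq hmn
  rw [legendreQ_eq_legQClosed hmn hs hz, legendreP_nat_eq hmn hz, legQClosed]
  have hz2 : z - 1 ≠ 0 := Complex.slitPlane_ne_zero hz
  have hz1 : z + 1 ≠ 0 := Complex.slitPlane_ne_zero (add_one_mem_slitPlane hz)
  have hX0 := cpow_ne_zero_of_ne hz2 ((m : ℂ) / 2)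
  have hY0 := cpow_ne_zero_of_ne hz1 ((m : ℂ) / 2)
  have hX := cpow_half_mul_self hz2 m
  have hY := cpow_half_mul_self hz1 m
  have hwm : ((1 - z) / 2) ^ m ≠ 0 := pow_ne_zero _ fun h => hz2 (by linear_combination -2 * h)
  have hwm' : (1 - (1 - z) / 2) ^ m ≠ 0 := pow_ne_zero _ fun h => hz1 (by linear_combination 2 * h)
  have hXw : (z - 1) ^ m = (-1) ^ m * 2 ^ m * ((1 - z) / 2) ^ m := by
    rw [← mul_pow, ← mul_pow]; congr 1; ring
  have hYw : (z + 1) ^ m = 2 ^ m * (1 - (1 - z) / 2) ^ m := by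
    rw [← mul_pow]; congr 1; ring
  rw [hXw] at hX
  rw [hYw] at hY
  have h2m : (2 : ℂ) ^ m ≠ 0 := pow_ne_zero _ two_ne_zero
  have hcomp : (legF n m 1).eval (1 - (1 - z) / 2) =
      (-1) ^ (n + m) * (legF n m 1).eval ((1 - z) / 2) := by
    have := congrArg (Polynomial.eval ((1 - z) / 2)) (legF_comp hmn)
    simpa [Polynomial.eval_comp] using this
  have k1 := eval_legF_combination hmn hsl ((1 - z) / 2)
  have k2 := eval_legF_combination hmn hsl (1 - (1 - z) / 2)
  rw [hcomp, sub_sub_cancel] at k2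
  -- All half powers are reduced to the single prefactor of P_n^m and integer powers of w and 1 - w,
  -- so that only field arithmetic remains.
  have b1 : (z - 1) ^ ((m : ℂ) / 2) * (z + 1) ^ ((m : ℂ) / 2) / 2 ^ m =
      (z + 1) ^ ((m : ℂ) / 2) / (z - 1) ^ ((m : ℂ) / 2) * ((-1) ^ m * ((1 - z) / 2) ^ m) := by
    rw [div_mul_eq_mul_div, div_eq_div_iff h2m hX0]
    linear_combination (z + 1) ^ ((m : ℂ) / 2) * hX
  have b2 : ((z - 1) ^ ((m : ℂ) / 2) * (z + 1) ^ ((m : ℂ) / 2) / 2 ^ m)⁻¹ =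
      (z + 1) ^ ((m : ℂ) / 2) / (z - 1) ^ ((m : ℂ) / 2) / (1 - (1 - z) / 2) ^ m := by
    rw [inv_div, div_div, div_eq_div_iff (mul_ne_zero hX0 hY0) (mul_ne_zero hX0 hwm')]
    linear_combination -(z - 1) ^ ((m : ℂ) / 2) * hY
  have b3 : (z - 1) ^ ((m : ℂ) / 2) / (z + 1) ^ ((m : ℂ) / 2) =
      (z + 1) ^ ((m : ℂ) / 2) / (z - 1) ^ ((m : ℂ) / 2) *
        ((-1) ^ m * ((1 - z) / 2) ^ m / (1 - (1 - z) / 2) ^ m) := by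
    rw [div_mul_div_comm, div_eq_div_iff hY0 (mul_ne_zero hX0 hwm')]
    linear_combination (1 - (1 - z) / 2) ^ m * hX - (-1) ^ m * ((1 - z) / 2) ^ m * hY
  rw [b1] at b2 ⊢
  rw [b2]
  rcases hε with rfl | rfl
  · rw [b3, one_mul z, one_pow, one_pow, mul_assoc ((-1) ^ (n + m)), ← k1]
    generalize (z + 1) ^ ((m : ℂ) / 2) / (z - 1) ^ ((m : ℂ) / 2) = q
    generalize (1 - (1 - z) / 2) ^ m = b at *
    generalize ((1 - z) / 2) ^ m = a at *
    generalize (-1 : ℂ) ^ m = c at *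
    field_simp
    ring
  · have e : (1 - -1 * z) / 2 = 1 - (1 - z) / 2 := by ring
    rw [e, sub_neg_eq_add, ← sub_eq_add_neg, neg_neg, one_pow]
    -- Exchanging w and 1 - w multiplies the combination by -(-1)^(n+m), so the identity at 1 - w
    -- computes the same quantity.
    have k3 : ((1 - z) / 2) ^ m * s.eval ((1 - z) / 2)
        - (-1) ^ (n + m) * (1 - (1 - z) / 2) ^ m * s.eval (1 - (1 - z) / 2) =
        -(-1) ^ (n + m) * ((1 - (1 - z) / 2) ^ m * s.eval (1 - (1 - z) / 2)
          - (-1) ^ (n + m) * (((1 - z) / 2) ^ m * s.eval ((1 - z) / 2))) := by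
      rcases neg_one_pow_eq_or ℂ (n + m) with h | h <;> rw [h] <;> ring
    rw [k3, ← k2, pow_add]
    generalize (z + 1) ^ ((m : ℂ) / 2) / (z - 1) ^ ((m : ℂ) / 2) = q
    generalize (1 - (1 - z) / 2) ^ m = b at *
    generalize ((1 - z) / 2) ^ m = a at *
    generalize Polynomial.eval (1 - (1 - z) / 2) (legF n m (digammaWeightF n m)) = x₁
    generalize Polynomial.eval (1 - (1 - z) / 2) (legR n m (digammaWeightR n m)) = x₂
    generalize Polynomial.eval (1 - (1 - z) / 2) (legSing n m) = x₃
    rcases neg_one_pow_eq_or ℂ m with hc | hc <;> rcases neg_one_pow_eq_or ℂ n with hd | hd <;>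
      rw [hc, hd] <;> field_simp <;> ring
end

theorem mainTheorem9 (n m : ℕ) (hmn : m ≤ n) (z : ℂ) (hz : z ∈ legendreDomain)
    (ε : ℂ) (hε : ε = 1 ∨ ε = -1) :
    (z.im ≠ 0 → Tendsto (fun ν => legendreQuot ν m z) (𝓝[≠] (n : ℂ)) (𝓝 (legendreQ n m z))) ∧
    (z.im = 0 → Tendsto (fun w => legendreQ n m w) (𝓝[{w : ℂ | w.im ≠ 0}] z)
      (𝓝 (legendreQ n m z))) ∧
    legendreQ n m z =
      1 / 2 * legendreP n m z * Complex.log ((z + 1) / (z - 1))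
      - ε * Complex.digamma (n + m + 1) * legendreP n m z
      + ε * (ε ^ n * (-ε) ^ m / 2) * ((n + m).factorial / (n - m).factorial : ℂ)
        * ((z - 1) ^ ((m : ℂ) / 2) * (z + 1) ^ ((m : ℂ) / 2) / 2 ^ m)⁻¹
        * ∑ k ∈ Finset.range m,
            (-ε) ^ k * ((k + n - m).factorial * (m - k - 1).factorial : ℂ)
              / (k.factorial * (n + m - k).factorial : ℂ) * ((z - ε) / 2) ^ k
      + ε * (ε ^ (n + m) / 2)
        * ((z - 1) ^ ((m : ℂ) / 2) * (z + 1) ^ ((m : ℂ) / 2) / 2 ^ m)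
        * ∑ k ∈ Finset.range (n - m + 1),
            ε ^ k * ((k + n + m).factorial : ℂ)
              / (k.factorial * (k + m).factorial * (n - m - k).factorial : ℂ)
              * (2 * Complex.digamma (k + n + m + 1) - Complex.digamma (k + m + 1)) * ((z - ε) / 2) ^ k
      - ε * (ε ^ n / 2) * ((n + m).factorial / (n - m).factorial : ℂ)
        * ((z - ε) ^ ((m : ℂ) / 2) / (z + ε) ^ ((m : ℂ) / 2))
        * ∑ k ∈ Finset.range (n + 1),
            ε ^ k * ((k + n).factorial : ℂ)
              / (k.factorial * (k + m).factorial * (n - k).factorial : ℂ)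
              * (2 * Complex.digamma (k + n + 1) - 2 * Complex.digamma (k + m + 1) - Complex.digamma (k + 1))
              * ((z - ε) / 2) ^ k := by
  have hε' : ε * ε = 1 := by rcases hε with rfl | rfl <;> norm_num
  refine ⟨fun h => tendsto_legendreQuot_legendreQ hmn h,
    fun h => tendsto_legendreQ_of_im_eq_zero hmn hz h, ?_⟩
  rw [legendreQ_eq hmn hz hε, ← sum_eq_eval_legSing n m hε', ← sum_eq_eval_legF n m hε',
    ← sum_eq_eval_legR n m hε']
  ring
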